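/- Let $n\in\mathbb N$, $\nu>0$, and let $W=(W(t))_{t\in\mathbb R}$ be a (two-sided) standard cylindrical Wiener process on $L^2([0,2\pi],\mathbb R^n)$, i.e. a centred jointly Gaussian family $W(t,h)$, $t\in\mathbb R$, $h\in L^2([0,2\pi],\mathbb R^n)$, with $\mathbf E\,W(t,h)W(s,g)=\tfrac12(|t|+|s|-|t-s|)\langle h,g\rangle$. For $\varepsilon\in(0,1)$, let $\psi^\varepsilon$ and $\psi^0$ be the stationary solutions, indexed by $t\in\mathbb R$ and driven by the same $W$, of the linear stochastic PDEs with periodic boundary conditions on $[0,2\pi]$ $$d\psi^\varepsilon=(\nu\partial_x^2-1)\psi^\varepsilon\,dt-\varepsilon^2\partial_x^4\psi^\varepsilon\,dt+\sqrt2\,dW(t),\qquad d\psi^0=(\nu\partial_x^2-1)\psi^0\,dt+\sqrt2\,dW(t).$$ (Solutions are weak solutions, tested against smooth $2\pi$-periodic functions, with almost surely continuous paths in $L^2([0,2\pi],\mathbb R^n)$; stationary means that the finite-dimensional distributions are invariant under time shifts.) For every $\kappa>0$ and every $T>0$ there is a constant $C$, depending only on $n$, $\nu$, $\kappa$ and $T$,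 such that for every $\varepsilon\in(0,1)$ the $[0,\infty]$-valued function $\sup_{t\in[0,T]}\|\psi^\varepsilon(t)-\psi^0(t)\|_{L^\infty}$ is measurable up to modification on a null set and $$\mathbf E\sup_{t\in[0,T]}\|\psi^\varepsilon(t)-\psi^0(t)\|_{L^\infty}\le C\,\varepsilon^{\frac12-\kappa}.$$ -/

import Mathlib

open MeasureTheory ProbabilityTheory
open scoped ENNReal

noncomputable section

/-- The Hilbert space `L²([0,2π], ℝⁿ)`. -/
abbrev PeriodicL2 (n : ℕ) : Type :=
  Lp (EuclideanSpace ℝ (Fin n)) 2 (volume.restrict (Set.Icc (0 : ℝ) (2 * Real.pi)))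

/-- A (two-sided) standard cylindrical Wiener process on a real Hilbert space `H`: a jointly Gaussian
centred family `W t h` with `E (W t h * W s g) = ⟪h, g⟫ * (|t| + |s| - |t - s|) / 2`. The factor
`(|t| + |s| - |t - s|) / 2` is the covariance of a Brownian motion indexed by the real line and started
from `0` at time `0`; it equals `min t s` for nonnegative times. -/
structure IsCylindricalWiener {H Ω : Type*} [NormedAddCommGroup H] [InnerProductSpace ℝ H]
    [MeasurableSpace Ω] (P : Measure Ω) (W : ℝ → H → Ω → ℝ) : Prop where
  gaussian : IsGaussianProcess (fun p : ℝ × H => W p.1 p.2) P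
  mean_zero : ∀ t h, ∫ ω, W t h ω ∂P = 0
  covariance : ∀ t s h g,
    ∫ ω, W t h ω * W s g ω ∂P = (|t| + |s| - |t - s|) / 2 * inner ℝ h g

/-- Smooth `2π`-periodic functions with values in `ℝⁿ`. -/
structure PeriodicTest (n : ℕ) where
  toFun : ℝ → EuclideanSpace ℝ (Fin n)
  smooth : ContDiff ℝ ((⊤ : ℕ∞) : WithTop ℕ∞) toFun
  periodic : Function.Periodic toFun (2 * Real.pi)

namespace PeriodicTest

variable {n : ℕ}

theorem memLp (φ : PeriodicTest n) :
    MemLp φ.toFun 2 (volume.restrict (Set.Icc (0 : ℝ) (2 * Real.pi))) := by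
  obtain ⟨C, hC⟩ := isCompact_Icc.exists_bound_of_continuousOn
    (s := Set.Icc (0 : ℝ) (2 * Real.pi)) φ.smooth.continuous.continuousOn
  exact MemLp.of_bound φ.smooth.continuous.aestronglyMeasurable C
    ((ae_restrict_iff' measurableSet_Icc).2 (Filter.Eventually.of_forall hC))

/-- The element of `L²([0,2π], ℝⁿ)` given by a test function. -/
def toL2 (φ : PeriodicTest n) : PeriodicL2 n := φ.memLp.toLp φ.toFun

/-- The operator `ν ∂ₓ² - 1 - ε² ∂ₓ⁴` acting on smooth periodic functions. -/
def linOp (ν ε : ℝ) (φ : PeriodicTest n) : PeriodicTest n where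
  toFun x := ν • iteratedDeriv 2 φ.toFun x - φ.toFun x - ε ^ 2 • iteratedDeriv 4 φ.toFun x
  smooth := by
    have h : ∀ k : ℕ, ContDiff ℝ ((⊤ : ℕ∞) : WithTop ℕ∞) (iteratedDeriv k φ.toFun) := fun k => by
      rw [iteratedDeriv_eq_iterate]
      exact φ.smooth.iterate_deriv k
    exact (((h 2).const_smul ν).sub φ.smooth).sub ((h 4).const_smul (ε ^ 2))
  periodic := by
    have h : ∀ (k : ℕ) (x : ℝ),
        iteratedDeriv k φ.toFun (x + 2 * Real.pi) = iteratedDeriv k φ.toFun x := fun k x => by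
      have h1 : (fun z => φ.toFun (z + 2 * Real.pi)) = φ.toFun := funext φ.periodic
      have h2 := congrFun (iteratedDeriv_comp_add_const k φ.toFun (2 * Real.pi)) x
      rw [h1] at h2
      exact h2.symm
    intro x
    simp only [h, φ.periodic x]

end PeriodicTest

/-- `ψ` is a stationary solution on the whole real time line, with continuous sample paths in
`L²([0,2π], ℝⁿ)`, of the linear stochastic partial differential equation
`dψ = (ν ∂ₓ² - 1) ψ dt - ε² ∂ₓ⁴ ψ dt + √2 dW` with periodic boundary conditions. The equation is
understood in the weak sense, i.e. tested against smooth periodic functions, and stationarity is the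
invariance of the finite-dimensional distributions under time shifts. -/
structure IsStationarySolution {n : ℕ} {Ω : Type*} [MeasurableSpace Ω] (P : Measure Ω)
    (W : ℝ → PeriodicL2 n → Ω → ℝ) (ν ε : ℝ) (ψ : ℝ → Ω → PeriodicL2 n) : Prop where
  measurable : ∀ t, AEStronglyMeasurable (ψ t) P
  continuous_paths : ∀ᵐ ω ∂P, Continuous fun t => ψ t ω
  weak_solution : ∀ (φ : PeriodicTest n) (s t : ℝ), s ≤ t → ∀ᵐ ω ∂P,
    inner ℝ (ψ t ω) φ.toL2 = inner ℝ (ψ s ω) φ.toL2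
      + (∫ r in s..t, inner ℝ (ψ r ω) (φ.linOp ν ε).toL2)
      + Real.sqrt 2 * (W t φ.toL2 ω - W s φ.toL2 ω)
  stationary : ∀ (τ : ℝ) (m : ℕ) (t : Fin m → ℝ) (h : Fin m → PeriodicL2 n),
    IdentDistrib (fun ω i => inner ℝ (ψ (t i + τ) ω) (h i))
      (fun ω i => inner ℝ (ψ (t i) ω) (h i)) P P

/-- The random variable `sup_{t ∈ [0,T]} ‖ψ₁(t) - ψ₂(t)‖_{L^∞}`, with values in `[0,∞]`. -/
def supLinftyDist {n : ℕ} {Ω : Type*} (T : ℝ) (ψ₁ ψ₂ : ℝ → Ω → PeriodicL2 n) (ω : Ω) : ℝ≥0∞ :=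
  ⨆ t ∈ Set.Icc (0 : ℝ) T,
    eLpNorm (fun x => ψ₁ t ω x - ψ₂ t ω x) ⊤ (volume.restrict (Set.Icc (0 : ℝ) (2 * Real.pi)))

end

open Filter Topology in
theorem exists_mesh_riemann_sum_error_le {X : ℝ → ℝ} (hX : Continuous X) (μ : ℝ) {s t η : ℝ}
    (hst : s ≤ t) (hη : 0 < η) :
    ∃ δ₀ > 0, ∀ δ, 0 < δ → δ < δ₀ → ∀ N : ℕ, s + N * δ = t →
      |∑ j ∈ Finset.range N, Real.exp (-(μ * (t - (s + j * δ)))) *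
          (X (s + (j + 1 : ℕ) * δ) - X (s + j * δ)
            + μ * ∫ r in (s + j * δ)..(s + (j + 1 : ℕ) * δ), X r)
        - (X t - Real.exp (-(μ * (t - s))) * X s)| ≤ η := by
  set c : ℝ → ℝ := fun r => Real.exp (-(μ * (t - r))) with hc
  have hcc : Continuous c := by fun_prop
  have hcd : ∀ r, HasDerivAt c (μ * c r) r := fun r => by
    have h1 : HasDerivAt (fun r => -(μ * (t - r))) μ r := by
      exact ((((hasDerivAt_id' r).const_sub t).const_mul μ).fun_neg).congr_deriv (by ring)
    simpa [hc, mul_comm] using h1.exp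
  have hη' : 0 < η / ((|μ| + 1) * (t - s + 1)) := by
    have : 0 < t - s + 1 := by linarith
    positivity
  have hu := (isCompact_Icc.prod isCompact_Icc : IsCompact (Set.Icc s t ×ˢ Set.Icc s t)).uniformContinuousOn_of_continuous
    (f := fun p : ℝ × ℝ => c p.1 * X p.2) (by fun_prop)
  rw [Metric.uniformContinuousOn_iff] at hu
  obtain ⟨δ₀, hδ₀, hu⟩ := hu _ hη'
  refine ⟨δ₀, hδ₀, fun δ hδ hδδ N hN => ?_⟩
  have hgrid : ∀ j : ℕ, j ≤ N → s + j * δ ∈ Set.Icc s t := fun j hj => by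
    have : (j : ℝ) ≤ N := by exact_mod_cast hj
    constructor
    · have : 0 ≤ j * δ := by positivity
      linarith
    · rw [← hN]; gcongr
  have htel : X t - c s * X s
      = ∑ j ∈ Finset.range N, (c (s + (j + 1 : ℕ) * δ) * X (s + (j + 1 : ℕ) * δ)
          - c (s + j * δ) * X (s + j * δ)) := by
    rw [Finset.sum_range_sub (fun j : ℕ => c (s + j * δ) * X (s + j * δ)), hN]
    simp [hc]
  have hcell : ∀ j ∈ Finset.range N, |c (s + j * δ) *
          (X (s + (j + 1 : ℕ) * δ) - X (s + j * δ)
            + μ * ∫ r in (s + j * δ)..(s + (j + 1 : ℕ) * δ), X r)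
        - (c (s + (j + 1 : ℕ) * δ) * X (s + (j + 1 : ℕ) * δ)
          - c (s + j * δ) * X (s + j * δ))| ≤ |μ| * (η / ((|μ| + 1) * (t - s + 1)) * δ) := by
    intro j hj
    have hj' := Finset.mem_range.1 hj
    have ha := hgrid j hj'.le
    have hb := hgrid (j + 1) hj'
    set a := s + j * δ with ha'
    set b := s + (j + 1 : ℕ) * δ with hb'
    have hab : b - a = δ := by rw [ha', hb']; push_cast; ring
    have hint : ∫ r in a..b, μ * c r = c b - c a :=
      intervalIntegral.integral_eq_sub_of_hasDerivAt (fun r _ => hcd r)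
        (by apply Continuous.intervalIntegrable; fun_prop)
    have : c a * (X b - X a + μ * ∫ r in a..b, X r) - (c b * X b - c a * X a)
        = μ * ∫ r in a..b, (c a * X r - c r * X b) := by
      rw [intervalIntegral.integral_sub, intervalIntegral.integral_const_mul,
        intervalIntegral.integral_mul_const]
      · rw [intervalIntegral.integral_const_mul] at hint
        linear_combination X b * hint
      · apply Continuous.intervalIntegrable; fun_prop
      · apply Continuous.intervalIntegrable; fun_prop
    rw [this, abs_mul]
    gcongr
    have := intervalIntegral.norm_integral_le_of_norm_le_const (a := a) (b := b)
      (f := fun r => c a * X r - c r * X b) (C := η / ((|μ| + 1) * (t - s + 1))) ?_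
    · rwa [hab, abs_of_pos hδ] at this
    · intro r hr
      rw [Set.uIoc_of_le (by linarith)] at hr
      have hrm : r ∈ Set.Icc s t := ⟨ha.1.trans hr.1.le, hr.2.trans hb.2⟩
      have := hu (a, r) ⟨ha, hrm⟩ (r, b) ⟨hrm, hb⟩ (by
        rw [Prod.dist_eq, max_lt_iff]
        simp only [Real.dist_eq, abs_lt]
        refine ⟨⟨?_, ?_⟩, ?_, ?_⟩ <;> linarith [hr.1, hr.2])
      exact this.le
  have hcs : Real.exp (-(μ * (t - s))) = c s := rfl
  rw [hcs, htel, ← Finset.sum_sub_distrib]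
  refine (Finset.abs_sum_le_sum_abs _ _).trans ((Finset.sum_le_sum hcell).trans ?_)
  rw [Finset.sum_const, Finset.card_range, nsmul_eq_mul]
  have h1 : (N : ℝ) * δ = t - s := by linarith
  have h2 : 0 ≤ t - s := by linarith
  have h3 : (N : ℝ) * (|μ| * (η / ((|μ| + 1) * (t - s + 1)) * δ))
      = η * ((|μ| * (t - s)) / ((|μ| + 1) * (t - s + 1))) := by
    rw [← h1]; ring
  rw [h3]
  refine mul_le_of_le_one_right hη.le (div_le_one_of_le₀ ?_ (by positivity))
  gcongr <;> linarith [abs_nonneg μ]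

section Gaussian

variable {H Ω : Type*} [NormedAddCommGroup H] [InnerProductSpace ℝ H] [MeasurableSpace Ω]
  {P : Measure Ω} {W : ℝ → H → Ω → ℝ}

theorem IsCylindricalWiener.memLp_two (hW : IsCylindricalWiener P W) (t : ℝ) (h : H) :
    MemLp (W t h) 2 P :=
  (hW.gaussian.hasGaussianLaw_eval (t, h)).memLp_two

theorem IsCylindricalWiener.isGaussianProcess_increments (hW : IsCylindricalWiener P W)
    {ι : Type*} (a b : ι → ℝ) (h : ι → H) (w : ι → ℝ) :
    IsGaussianProcess (fun i ω => w i * (W (b i) (h i) ω - W (a i) (h i) ω)) P := by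
  classical
  exact hW.gaussian.of_isGaussianProcess fun i => ⟨{(b i, h i), (a i, h i)},
    { toFun x := w i * (x ⟨(b i, h i), by simp⟩ - x ⟨(a i, h i), by simp⟩)
      map_add' x y := by simp; ring
      map_smul' c x := by simp; ring },
    by simp⟩

theorem IsCylindricalWiener.integral_increment_mul (hW : IsCylindricalWiener P W)
    (a b a' b' : ℝ) (h h' : H) :
    ∫ ω, (W b h ω - W a h ω) * (W b' h' ω - W a' h' ω) ∂P
      = (|b - a'| + |a - b'| - |b - b'| - |a - a'|) / 2 * inner ℝ h h' := by
  have hi : ∀ t s g g', Integrable (fun ω => W t g ω * W s g' ω) P := fun t s g g' =>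
    (hW.memLp_two t g).integrable_mul (hW.memLp_two s g')
  have : (fun ω => (W b h ω - W a h ω) * (W b' h' ω - W a' h' ω))
      = fun ω => (W b h ω * W b' h' ω - W b h ω * W a' h' ω)
        - (W a h ω * W b' h' ω - W a h ω * W a' h' ω) := by
    funext ω; ring
  have hd : ∀ t s u g g', Integrable (fun ω => W t g ω * W s g' ω - W t g ω * W u g' ω) P :=
    fun t s u g g' => (hi _ _ _ _).sub (hi _ _ _ _)
  rw [this, integral_sub (hd _ _ _ _ _) (hd _ _ _ _ _),
    integral_sub (hi _ _ _ _) (hi _ _ _ _), integral_sub (hi _ _ _ _) (hi _ _ _ _)]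
  simp only [hW.covariance]
  ring

theorem IsCylindricalWiener.lintegral_exp_sum_increments (hW : IsCylindricalWiener P W)
    {ι : Type*} [Fintype ι] {h : ι → H} (hh : Orthonormal ℝ h) (s : ℝ) {δ : ℝ} (hδ : 0 < δ)
    (N : ℕ) (w : ι → ℕ → ℝ) (l : ℝ) :
    ∫⁻ ω, ENNReal.ofReal (Real.exp (l * ∑ i, ∑ j ∈ Finset.range N, w i j *
        (W (s + (j + 1 : ℕ) * δ) (h i) ω - W (s + j * δ) (h i) ω))) ∂P
      = ENNReal.ofReal (Real.exp (l ^ 2 * (∑ i, ∑ j ∈ Finset.range N, w i j ^ 2) * δ / 2)) := by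
  classical
  set Y : ι × ℕ → Ω → ℝ := fun p ω => w p.1 p.2 *
    (W (s + (p.2 + 1 : ℕ) * δ) (h p.1) ω - W (s + p.2 * δ) (h p.1) ω) with hY
  have hG : IsGaussianProcess Y P :=
    hW.isGaussianProcess_increments (fun p : ι × ℕ => s + p.2 * δ)
      (fun p => s + (p.2 + 1 : ℕ) * δ) (fun p => h p.1) (fun p => w p.1 p.2)
  set I : Finset (ι × ℕ) := Finset.univ ×ˢ Finset.range N with hI
  have hPr : IsProbabilityMeasure P := hG.isProbabilityMeasure
  have hZ : ∀ ω, ∑ i, ∑ j ∈ Finset.range N, w i j *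
        (W (s + (j + 1 : ℕ) * δ) (h i) ω - W (s + j * δ) (h i) ω) = ∑ p ∈ I, Y p ω := fun ω => by
    rw [hI, Finset.sum_product]
  have hZG : HasGaussianLaw (fun ω => ∑ p ∈ I, Y p ω) P := hG.hasGaussianLaw_fun_sum
  have hYm : ∀ p, MemLp (Y p) 2 P := fun p => (hG.hasGaussianLaw_eval p).memLp_two
  have hY0 : ∀ p, ∫ ω, Y p ω ∂P = 0 := fun p => by
    simp only [hY]
    rw [integral_const_mul, integral_sub ((hW.memLp_two _ _).integrable (by norm_num))
      ((hW.memLp_two _ _).integrable (by norm_num)), hW.mean_zero, hW.mean_zero]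
    simp
  have hmean : ∫ ω, ∑ p ∈ I, Y p ω ∂P = 0 := by
    rw [integral_finsetSum _ fun p _ => (hYm p).integrable (by norm_num)]
    simp [hY0]
  have hcov : ∀ p q, cov[Y p, Y q; P] = if p = q then w p.1 p.2 ^ 2 * δ else 0 := by
    rintro ⟨i, j⟩ ⟨i', j'⟩
    rw [covariance_eq_sub (hYm _) (hYm _), hY0, hY0]
    have : (Y (i, j) * Y (i', j')) = fun ω => (w i j * w i' j') *
        ((W (s + (j + 1 : ℕ) * δ) (h i) ω - W (s + j * δ) (h i) ω) *
          (W (s + (j' + 1 : ℕ) * δ) (h i') ω - W (s + j' * δ) (h i') ω)) := by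
      funext ω; simp only [hY, Pi.mul_apply]; ring
    rw [this, integral_const_mul, hW.integral_increment_mul, orthonormal_iff_ite.1 hh]
    have e1 : s + (j + 1 : ℕ) * δ - (s + j' * δ) = (j - j' + 1) * δ := by push_cast; ring
    have e2 : s + j * δ - (s + (j' + 1 : ℕ) * δ) = (j - j' - 1) * δ := by push_cast; ring
    have e3 : s + (j + 1 : ℕ) * δ - (s + (j' + 1 : ℕ) * δ) = (j - j') * δ := by push_cast; ring
    have e4 : s + j * δ - (s + j' * δ) = (j - j') * δ := by ring
    rw [e1, e2, e3, e4]
    simp only [abs_mul, abs_of_pos hδ, Prod.mk.injEq]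
    by_cases hi : i = i'
    · subst hi
      simp only [if_true, true_and]
      rcases lt_trichotomy j j' with hj | hj | hj
      · have : (j : ℝ) + 1 ≤ j' := by exact_mod_cast hj
        rw [abs_of_nonpos (by linarith), abs_of_nonpos (by linarith),
          abs_of_nonpos (by linarith), if_neg hj.ne]
        ring
      · subst hj
        simp only [sub_self, zero_add, zero_sub, abs_one, abs_neg, if_true, abs_zero]
        ring
      · have : (j' : ℝ) + 1 ≤ j := by exact_mod_cast hj
        rw [abs_of_nonneg (by linarith), abs_of_nonneg (by linarith),
          abs_of_nonneg (by linarith), if_neg hj.ne']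
        ring
    · simp [hi]
  have hvar : Var[fun ω => ∑ p ∈ I, Y p ω; P] = (∑ p ∈ I, w p.1 p.2 ^ 2) * δ := by
    rw [variance_fun_sum' fun p _ => hYm p, Finset.sum_mul]
    refine Finset.sum_congr rfl fun p hp => ?_
    simp [hcov, hp]
  have hmap := hZG.map_eq_gaussianReal
  have hmgf := mgf_gaussianReal hmap l
  simp only [hZ]
  rw [hmean, hvar] at hmap hmgf
  have hpos := mgf_pos_iff.1 ((hmgf ▸ Real.exp_pos _ : 0 < mgf (fun ω => ∑ p ∈ I, Y p ω) P l))
  have hnn : 0 ≤ (∑ p ∈ I, w p.1 p.2 ^ 2) * δ := by positivity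
  rw [← ofReal_integral_eq_lintegral_ofReal hpos (ae_of_all _ fun _ => (Real.exp_pos _).le)]
  rw [mgf] at hmgf
  rw [hmgf, Real.coe_toNNReal _ hnn, hI, Finset.sum_product]
  congr 2
  ring

end Gaussian

section OrnsteinUhlenbeck

open Filter Topology

variable {Ω : Type*} [MeasurableSpace Ω] {P : Measure Ω}

/-- `X` is a process with continuous paths and time-independent one-dimensional marginals that solves
`dX = - μ X dt + √2 dw`. -/
structure IsOrnsteinUhlenbeck (P : Measure Ω) (μ : ℝ) (w X : ℝ → Ω → ℝ) : Prop where
  aemeasurable : ∀ t, AEMeasurable (X t) P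
  continuous_paths : ∀ᵐ ω ∂P, Continuous fun t => X t ω
  equation : ∀ s t : ℝ, s ≤ t → ∀ᵐ ω ∂P,
    X t ω = X s ω - μ * (∫ r in s..t, X r ω) + Real.sqrt 2 * (w t ω - w s ω)
  stationary : ∀ t, IdentDistrib (X t) (X 0) P P

theorem tendstoInMeasure_mul_zero_of_identDistrib [IsFiniteMeasure P] {Y : ℕ → Ω → ℝ} {Y₀ : Ω → ℝ}
    (hY : ∀ i, IdentDistrib (Y i) Y₀ P P) {c : ℕ → ℝ} (hc : Tendsto c atTop (𝓝 0)) :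
    TendstoInMeasure P (fun i ω => c i * Y i ω) atTop fun _ => 0 := by
  have h0 : TendstoInMeasure P (fun i ω => c i * Y₀ ω) atTop fun _ => 0 := by
    refine tendstoInMeasure_of_tendsto_ae
      (fun i => ((hY i).aemeasurable_snd.const_mul (c i)).aestronglyMeasurable) ?_
    refine ae_of_all _ fun ω => ?_
    simpa using hc.mul_const (Y₀ ω)
  rw [tendstoInMeasure_iff_norm] at h0 ⊢
  intro ε hε
  refine (h0 ε hε).congr fun i => ?_
  have hm : MeasurableSet {y : ℝ | ε ≤ ‖c i * y - 0‖} :=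
    measurableSet_le measurable_const (by fun_prop)
  exact ((hY i).measure_mem_eq hm).symm

theorem tendstoInMeasure_finset_sum_zero {ι : Type*} (s : Finset ι) {R : ι → ℕ → Ω → ℝ}
    (hR : ∀ l ∈ s, TendstoInMeasure P (R l) atTop fun _ => 0) :
    TendstoInMeasure P (fun i ω => ∑ l ∈ s, R l i ω) atTop fun _ => 0 := by
  rw [tendstoInMeasure_iff_norm]
  intro ε hε
  have hε' : 0 < ε / (s.card + 1) := by positivity
  have hlim : Tendsto (fun i => ∑ l ∈ s, P {ω | ε / (s.card + 1) ≤ ‖R l i ω - 0‖}) atTop (𝓝 0) := by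
    have := tendsto_finsetSum s (fun l hl => (tendstoInMeasure_iff_norm.1 (hR l hl)) _ hε')
    simpa using this
  refine tendsto_of_tendsto_of_tendsto_of_le_of_le tendsto_const_nhds hlim (fun _ => zero_le)
    fun i => ?_
  refine (measure_mono fun ω hω => ?_).trans (measure_biUnion_finset_le s _)
  simp only [Set.mem_iUnion, Set.mem_ofPred_eq, sub_zero] at hω ⊢
  by_contra! hcon
  have h1 : ‖∑ l ∈ s, R l i ω‖ ≤ ∑ l ∈ s, ε / (s.card + 1) :=
    (norm_sum_le _ _).trans (Finset.sum_le_sum fun l hl => (hcon l hl).le)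
  rw [Finset.sum_const, nsmul_eq_mul] at h1
  have h2 : (s.card : ℝ) * (ε / (s.card + 1)) < ε := by
    rw [mul_div_assoc', div_lt_iff₀ (by positivity)]
    nlinarith
  linarith

theorem lintegral_exp_le_of_tendstoInMeasure {Z : ℕ → Ω → ℝ} {Z₀ : Ω → ℝ}
    (hZ : ∀ i, AEMeasurable (Z i) P) (hlim : TendstoInMeasure P Z atTop Z₀) {l : ℝ} {E : ℝ≥0∞}
    (hE : ∀ i, ∫⁻ ω, ENNReal.ofReal (Real.exp (l * Z i ω)) ∂P ≤ E) :
    ∫⁻ ω, ENNReal.ofReal (Real.exp (l * Z₀ ω)) ∂P ≤ E := by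
  obtain ⟨ns, -, hns⟩ := hlim.exists_seq_tendsto_ae
  calc ∫⁻ ω, ENNReal.ofReal (Real.exp (l * Z₀ ω)) ∂P
      = ∫⁻ ω, liminf (fun i => ENNReal.ofReal (Real.exp (l * Z (ns i) ω))) atTop ∂P := by
        refine lintegral_congr_ae ?_
        filter_upwards [hns] with ω hω
        have hc : Continuous fun x : ℝ => ENNReal.ofReal (Real.exp (l * x)) :=
          ENNReal.continuous_ofReal.comp (by fun_prop)
        exact ((hc.tendsto _).comp hω).liminf_eq.symm
    _ ≤ liminf (fun i => ∫⁻ ω, ENNReal.ofReal (Real.exp (l * Z (ns i) ω)) ∂P) atTop := by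
        refine lintegral_liminf_le' fun i => ?_
        exact (Real.measurable_exp.comp_aemeasurable ((hZ _).const_mul l)).ennreal_ofReal
    _ ≤ E := by
        refine (liminf_le_liminf (Eventually.of_forall fun i => hE (ns i))).trans ?_
        simp

variable {H : Type*} [NormedAddCommGroup H] [InnerProductSpace ℝ H] {W : ℝ → H → Ω → ℝ}

/-- The weight of the `j`-th noise increment in the Riemann sum, with mesh `δ`, for an
Ornstein-Uhlenbeck process of rate `μ` evaluated at the grid point with index `J`. -/
noncomputable def ouKernel (μ δ : ℝ) (J j : ℕ) : ℝ :=
  if j < J then Real.exp (-(μ * ((J - j : ℝ) * δ))) else 0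

theorem sum_ouKernel_mul (μ δ : ℝ) {J N : ℕ} (hJ : J ≤ N) (f : ℕ → ℝ) :
    ∑ j ∈ Finset.range N, ouKernel μ δ J j * f j
      = ∑ j ∈ Finset.range J, Real.exp (-(μ * ((J - j : ℝ) * δ))) * f j := by
  have : Finset.range J = (Finset.range N).filter (· < J) := by
    ext j; simp; omega
  rw [this, Finset.sum_filter]
  refine Finset.sum_congr rfl fun j _ => ?_
  unfold ouKernel
  split_ifs <;> simp

theorem lintegral_exp_ornsteinUhlenbeck_le (hW : IsCylindricalWiener P W)
    {ι Q : Type*} [Fintype ι] [Fintype Q] {h : ι → H} (hh : Orthonormal ℝ h)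
    {μ : ι → Q → ℝ} (hμ : ∀ i q, 0 < μ i q) {X : ι → Q → ℝ → Ω → ℝ}
    (hX : ∀ i q, IsOrnsteinUhlenbeck P (μ i q) (fun t => W t (h i)) (X i q))
    {τ : ℝ} (hτ : 0 < τ) (M₀ : ℕ) (n : Q → ℕ) (a : ι → Q → ℝ) (B : ι → ℝ)
    (hB : ∀ δ : ℝ, 0 < δ → ∀ (J : Q → ℕ) (N : ℕ),
      (∀ q q', ((J q : ℝ) - J q') * δ = ((n q : ℝ) - n q') * (τ / 2 ^ M₀)) →
      ∀ i, (∑ j ∈ Finset.range N, (∑ q, a i q * ouKernel (μ i q) δ (J q) j) ^ 2) * δ ≤ B i)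
    (l : ℝ) :
    ∫⁻ ω, ENNReal.ofReal (Real.exp (l * ∑ i, ∑ q, a i q * X i q (n q * (τ / 2 ^ M₀)) ω)) ∂P
      ≤ ENNReal.ofReal (Real.exp (l ^ 2 * ∑ i, B i)) := by
  have hPr : IsProbabilityMeasure P := hW.gaussian.isProbabilityMeasure
  set t : Q → ℝ := fun q => n q * (τ / 2 ^ M₀) with ht
  have ht0 : ∀ q, 0 ≤ t q := fun q => by positivity
  have hfin : ∀ S : ℕ, ∫⁻ ω, ENNReal.ofReal (Real.exp (l * ∑ i, ∑ q, a i q *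
      (X i q (t q) ω - Real.exp (-(μ i q * (t q - -(S * τ)))) * X i q (-(S * τ)) ω))) ∂P
        ≤ ENNReal.ofReal (Real.exp (l ^ 2 * ∑ i, B i)) := by
    intro S
    set s : ℝ := -(S * τ) with hs
    set δ : ℕ → ℝ := fun m => τ / 2 ^ (M₀ + m) with hδ
    have hδ0 : ∀ m, 0 < δ m := fun m => by positivity
    set J : ℕ → Q → ℕ := fun m q => S * 2 ^ (M₀ + m) + n q * 2 ^ m with hJ
    have hJt : ∀ m q, s + J m q * δ m = t q := fun m q => by
      simp only [hs, hJ, hδ, ht]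
      push_cast
      rw [pow_add]
      field_simp
      ring
    set N : ℕ → ℕ := fun m => ∑ q, J m q with hN
    have hJN : ∀ m q, J m q ≤ N m := fun m q =>
      Finset.single_le_sum (f := fun q => J m q) (fun _ _ => Nat.zero_le _) (Finset.mem_univ q)
    set w : ℕ → ι → ℕ → ℝ := fun m i j =>
      Real.sqrt 2 * ∑ q, a i q * ouKernel (μ i q) (δ m) (J m q) j with hw
    have hδlim : Tendsto δ atTop (𝓝 0) := by
      have h1 : Tendsto (fun m : ℕ => τ / 2 ^ M₀ * (1 / 2 : ℝ) ^ m) atTop (𝓝 (τ / 2 ^ M₀ * 0)) :=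
        (tendsto_pow_atTop_nhds_zero_of_lt_one (by norm_num) (by norm_num)).const_mul _
      rw [mul_zero] at h1
      refine h1.congr fun m => ?_
      simp only [hδ, pow_add, one_div, inv_pow]
      field_simp
    set Z : ℕ → Ω → ℝ := fun m ω => ∑ i, ∑ j ∈ Finset.range (N m), w m i j *
        (W (s + (j + 1 : ℕ) * δ m) (h i) ω - W (s + j * δ m) (h i) ω) with hZ
    have hZm : ∀ m, AEMeasurable (Z m) P := fun m => by
      refine Finset.aemeasurable_fun_sum _ fun i _ => Finset.aemeasurable_fun_sum _ fun j _ => ?_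
      exact ((hW.memLp_two _ _).aemeasurable.sub (hW.memLp_two _ _).aemeasurable).const_mul _
    refine lintegral_exp_le_of_tendstoInMeasure hZm (l := l) ?_ fun m => ?_
    · refine tendstoInMeasure_of_tendsto_ae (fun m => (hZm m).aestronglyMeasurable) ?_
      have heq : ∀ᵐ ω ∂P, ∀ i q, ∀ m j : ℕ, X i q (s + (j + 1 : ℕ) * δ m) ω
          = X i q (s + j * δ m) ω
            - μ i q * (∫ r in (s + j * δ m)..(s + (j + 1 : ℕ) * δ m), X i q r ω)
            + Real.sqrt 2 * (W (s + (j + 1 : ℕ) * δ m) (h i) ω - W (s + j * δ m) (h i) ω) := by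
        simp only [eventually_countable_forall]
        intro i q m j
        refine (hX i q).equation _ _ ?_
        have := (hδ0 m).le
        push_cast
        nlinarith
      have hcont : ∀ᵐ ω ∂P, ∀ i q, Continuous fun t => X i q t ω := by
        simp only [eventually_countable_forall]
        exact fun i q => (hX i q).continuous_paths
      filter_upwards [heq, hcont] with ω hω hωc
      have hrw : ∀ m, Z m ω = ∑ i, ∑ q, a i q * ∑ j ∈ Finset.range (J m q),
          Real.exp (-(μ i q * (t q - (s + j * δ m)))) *
          (X i q (s + (j + 1 : ℕ) * δ m) ω - X i q (s + j * δ m) ω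
            + μ i q * ∫ r in (s + j * δ m)..(s + (j + 1 : ℕ) * δ m), X i q r ω) := by
        intro m
        simp only [hZ, hw]
        refine Finset.sum_congr rfl fun i _ => ?_
        have e1 : ∀ j : ℕ, (Real.sqrt 2 * ∑ q, a i q * ouKernel (μ i q) (δ m) (J m q) j) *
            (W (s + (j + 1 : ℕ) * δ m) (h i) ω - W (s + j * δ m) (h i) ω)
            = ∑ q, a i q * (ouKernel (μ i q) (δ m) (J m q) j * (Real.sqrt 2 *
              (W (s + (j + 1 : ℕ) * δ m) (h i) ω - W (s + j * δ m) (h i) ω))) := fun j => by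
          rw [Finset.mul_sum, Finset.sum_mul]
          exact Finset.sum_congr rfl fun q _ => by ring
        simp only [e1]
        rw [Finset.sum_comm]
        refine Finset.sum_congr rfl fun q _ => ?_
        rw [← Finset.mul_sum, sum_ouKernel_mul _ _ (hJN m q)]
        congr 1
        refine Finset.sum_congr rfl fun j _ => ?_
        rw [← hJt m q, hω i q m j]
        congr 1
        · congr 3; ring
        · ring
      simp only [hrw]
      refine tendsto_finsetSum _ fun i _ => tendsto_finsetSum _ fun q _ => Tendsto.const_mul _ ?_
      rw [Metric.tendsto_atTop']
      intro η hη
      obtain ⟨δ₀, hδ₀, hR⟩ := exists_mesh_riemann_sum_error_le (hωc i q) (μ i q)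
        (s := s) (t := t q) (η := η / 2) (by
          have : 0 ≤ S * τ := by positivity
          linarith [ht0 q]) (by positivity)
      obtain ⟨m₀, hm₀⟩ := eventually_atTop.1 (hδlim.eventually (gt_mem_nhds hδ₀))
      refine ⟨m₀, fun m hm => ?_⟩
      rw [Real.dist_eq]
      exact (hR (δ m) (hδ0 m) (hm₀ m hm.le) (J m q) (hJt m q)).trans_lt (by linarith)
    · rw [hW.lintegral_exp_sum_increments hh s (hδ0 m) (N m) (w m) l]
      refine ENNReal.ofReal_le_ofReal (Real.exp_le_exp.2 ?_)
      have hBi := fun i => hB (δ m) (hδ0 m) (J m) (N m) (fun q q' => by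
        have h1 := hJt m q
        have h2 := hJt m q'
        simp only [ht] at h1 h2
        linear_combination h1 - h2) i
      have hwi : ∀ i, (∑ j ∈ Finset.range (N m), w m i j ^ 2) * δ m / 2 ≤ B i := fun i => by
        refine le_trans (le_of_eq ?_) (hBi i)
        simp only [hw, mul_pow, Real.sq_sqrt (zero_le_two), ← Finset.mul_sum]
        ring
      calc l ^ 2 * (∑ i, ∑ j ∈ Finset.range (N m), w m i j ^ 2) * δ m / 2
          = l ^ 2 * ∑ i, (∑ j ∈ Finset.range (N m), w m i j ^ 2) * δ m / 2 := by
            rw [← Finset.sum_div, ← Finset.sum_mul]; ring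
        _ ≤ l ^ 2 * ∑ i, B i := by
            gcongr with i
            exact hwi i
  set R : ι → Q → ℕ → Ω → ℝ := fun i q S ω =>
    (a i q * Real.exp (-(μ i q * (t q - -(S * τ))))) * X i q (-(S * τ)) ω with hR
  have hRlim : TendstoInMeasure P (fun S ω => ∑ p : ι × Q, R p.1 p.2 S ω) atTop fun _ => 0 := by
    refine tendstoInMeasure_finset_sum_zero (R := fun p : ι × Q => R p.1 p.2) _ fun p _ => ?_
    refine tendstoInMeasure_mul_zero_of_identDistrib (fun S => (hX p.1 p.2).stationary _) ?_
    rw [← mul_zero (a p.1 p.2)]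
    refine Tendsto.const_mul _ (Real.tendsto_exp_neg_atTop_nhds_zero.comp ?_)
    refine Tendsto.const_mul_atTop (hμ _ _) ?_
    simp only [sub_neg_eq_add]
    exact tendsto_atTop_add_const_left _ _ (tendsto_natCast_atTop_atTop.atTop_mul_const hτ)
  refine lintegral_exp_le_of_tendstoInMeasure (fun S => ?_) ?_ hfin
  · refine Finset.aemeasurable_fun_sum _ fun i _ => Finset.aemeasurable_fun_sum _ fun q _ => ?_
    exact (((hX i q).aemeasurable _).sub (((hX i q).aemeasurable _).const_mul _)).const_mul _
  · rw [tendstoInMeasure_iff_norm] at hRlim ⊢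
    intro ε hε
    refine (hRlim ε hε).congr fun S => ?_
    congr 2
    ext ω
    congr! 1
    rw [sub_zero, Fintype.sum_prod_type, ← norm_neg]
    congr 1
    rw [← Finset.sum_sub_distrib, ← Finset.sum_neg_distrib]
    refine Finset.sum_congr rfl fun i _ => ?_
    rw [← Finset.sum_sub_distrib, ← Finset.sum_neg_distrib]
    refine Finset.sum_congr rfl fun q _ => ?_
    simp only [hR]
    ring

end OrnsteinUhlenbeck

section Kernel

theorem sum_range_exp_mul_le {μ δ : ℝ} (hμ : 0 < μ) (J : ℕ) :
    (∑ j ∈ Finset.range J, Real.exp (-(μ * ((J - j : ℝ) * δ)))) * δ ≤ 1 / μ := by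
  induction J with
  | zero => simp; positivity
  | succ J ih =>
    have h1 : (∑ j ∈ Finset.range (J + 1), Real.exp (-(μ * (((J + 1 : ℕ) - j : ℝ) * δ)))) * δ
        = Real.exp (-(μ * δ)) *
          ((∑ j ∈ Finset.range J, Real.exp (-(μ * ((J - j : ℝ) * δ)))) * δ + δ) := by
      rw [Finset.sum_range_succ, mul_add, add_mul, ← mul_assoc (Real.exp _), Finset.mul_sum]
      congr 1
      · congr 1
        refine Finset.sum_congr rfl fun j _ => ?_
        rw [← Real.exp_add]
        congr 1
        push_cast
        ring
      · congr 2
        push_cast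
        ring
    rw [h1, Real.exp_neg, inv_mul_le_iff₀ (Real.exp_pos _)]
    have h2 := Real.add_one_le_exp (μ * δ)
    calc _ ≤ 1 / μ + δ := by gcongr
      _ = (μ * δ + 1) * (1 / μ) := by field_simp; ring
      _ ≤ _ := by gcongr

theorem ouKernel_nonneg (μ δ : ℝ) (J j : ℕ) : 0 ≤ ouKernel μ δ J j := by
  unfold ouKernel
  split_ifs
  · positivity
  · exact le_rfl

theorem sum_ouKernel_le {μ δ : ℝ} (hμ : 0 < μ) (hδ : 0 < δ) (J N : ℕ) :
    (∑ j ∈ Finset.range N, ouKernel μ δ J j) * δ ≤ 1 / μ := by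
  refine le_trans ?_ (sum_range_exp_mul_le (δ := δ) hμ J)
  have h1 : ∑ j ∈ Finset.range N, ouKernel μ δ J j
      ≤ ∑ j ∈ Finset.range (max J N), ouKernel μ δ J j :=
    Finset.sum_le_sum_of_subset_of_nonneg
      (Finset.range_subset_range.2 (le_max_right _ _)) fun _ _ _ => ouKernel_nonneg _ _ _ _
  have h2 := sum_ouKernel_mul μ δ (le_max_left J N) (fun _ => 1)
  simp only [mul_one] at h2
  rw [← h2]
  gcongr

theorem ouKernel_sq (μ δ : ℝ) (J j : ℕ) : ouKernel μ δ J j ^ 2 = ouKernel (2 * μ) δ J j := by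
  unfold ouKernel
  split_ifs
  · rw [← Real.exp_nat_mul]
    congr 1
    push_cast
    ring
  · norm_num

theorem sq_one_sub_exp_neg_le {x : ℝ} (hx : 0 ≤ x) : (1 - Real.exp (-x)) ^ 2 ≤ min 1 x := by
  have h1 := Real.add_one_le_exp (-x)
  have h2 : Real.exp (-x) ≤ 1 := Real.exp_le_one_iff.2 (by linarith)
  have h3 := Real.exp_pos (-x)
  refine le_min ?_ ?_ <;> nlinarith

theorem min_one_le_rpow {x p : ℝ} (hx : 0 ≤ x) (hp0 : 0 ≤ p) (hp1 : p ≤ 1) : min 1 x ≤ x ^ p := by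
  rcases le_total 1 x with h | h
  · exact (min_le_left _ _).trans (Real.one_le_rpow h hp0)
  · refine (min_le_right _ _).trans ?_
    exact Real.self_le_rpow_of_le_one hx h hp1

theorem rpow_le_exp {x p : ℝ} (hx : 0 ≤ x) (hp0 : 0 ≤ p) (hp1 : p ≤ 1) : x ^ p ≤ Real.exp x := by
  rcases le_total 1 x with h | h
  · have := Real.rpow_le_rpow_of_exponent_le h hp1
    rw [Real.rpow_one] at this
    linarith [Real.add_one_le_exp x]
  · exact (Real.rpow_le_one hx h hp0).trans (Real.one_le_exp hx)

theorem ouKernel_sub_sq_le {a b δ p : ℝ} (ha : 0 < a) (hb : 0 ≤ b) (hδ : 0 < δ) (hp0 : 0 ≤ p)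
    (hp1 : p ≤ 1) (J j : ℕ) :
    (ouKernel (a + b) δ J j - ouKernel a δ J j) ^ 2 ≤ (b / a) ^ p * ouKernel a δ J j := by
  unfold ouKernel
  split_ifs with h
  · have h' : (j : ℝ) < J := by exact_mod_cast h
    set u : ℝ := (J - j : ℝ) * δ with hu
    have hu0 : 0 < u := mul_pos (by linarith) hδ
    have e1 : Real.exp (-((a + b) * u)) - Real.exp (-(a * u))
        = -(Real.exp (-(a * u)) * (1 - Real.exp (-(b * u)))) := by
      rw [mul_sub, ← Real.exp_add]
      ring_nf
    have hbu : 0 ≤ b * u := by positivity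
    have hau : 0 ≤ a * u := by positivity
    have h2 : (1 - Real.exp (-(b * u))) ^ 2 ≤ (b / a) ^ p * Real.exp (a * u) := by
      refine (sq_one_sub_exp_neg_le hbu).trans ((min_one_le_rpow hbu hp0 hp1).trans ?_)
      have : b * u = b / a * (a * u) := by field_simp
      rw [this, Real.mul_rpow (by positivity) hau]
      gcongr
      exact rpow_le_exp hau hp0 hp1
    rw [e1, neg_sq, mul_pow]
    calc Real.exp (-(a * u)) ^ 2 * (1 - Real.exp (-(b * u))) ^ 2
        ≤ Real.exp (-(a * u)) ^ 2 * ((b / a) ^ p * Real.exp (a * u)) := by gcongr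
      _ = (b / a) ^ p * Real.exp (-(a * u)) := by
        have : Real.exp (-(a * u)) * Real.exp (a * u) = 1 := by rw [← Real.exp_add]; simp
        linear_combination (b / a) ^ p * Real.exp (-(a * u)) * this
  · simp

theorem sum_ouKernel_sub_sq_le {a b δ p : ℝ} (ha : 0 < a) (hb : 0 ≤ b) (hδ : 0 < δ) (hp0 : 0 ≤ p)
    (hp1 : p ≤ 1) (J N : ℕ) :
    (∑ j ∈ Finset.range N, (ouKernel (a + b) δ J j - ouKernel a δ J j) ^ 2) * δ
      ≤ (b / a) ^ p / a := by
  calc _ ≤ (∑ j ∈ Finset.range N, (b / a) ^ p * ouKernel a δ J j) * δ := by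
        gcongr with j
        exact ouKernel_sub_sq_le ha hb hδ hp0 hp1 J j
    _ = (b / a) ^ p * ((∑ j ∈ Finset.range N, ouKernel a δ J j) * δ) := by
        rw [← Finset.mul_sum]; ring
    _ ≤ (b / a) ^ p * (1 / a) := by
        gcongr
        exact sum_ouKernel_le ha hδ J N
    _ = _ := by ring

theorem sum_ouKernel_time_sub_sq_le_of_le {μ δ : ℝ} (hμ : 0 < μ) (hδ : 0 < δ) {J J' : ℕ}
    (hJ : J' ≤ J) (N : ℕ) :
    (∑ j ∈ Finset.range N, (ouKernel μ δ J j - ouKernel μ δ J' j) ^ 2) * δ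
      ≤ 2 * ((J - J' : ℝ) * δ) := by
  have hJr : (J' : ℝ) ≤ J := by exact_mod_cast hJ
  set h : ℝ := (J - J' : ℝ) * δ with hh
  have hh0 : 0 ≤ h := mul_nonneg (by linarith) hδ.le
  have hterm : ∀ j, (ouKernel μ δ J j - ouKernel μ δ J' j) ^ 2
      ≤ μ * h * ouKernel (2 * μ) δ J' j + if J' ≤ j ∧ j < J then 1 else 0 := by
    intro j
    rcases lt_or_ge j J' with h1 | h1
    · rw [if_neg (by omega), add_zero, ← ouKernel_sq]
      have e : ouKernel μ δ J j = ouKernel μ δ J' j * Real.exp (-(μ * h)) := by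
        unfold ouKernel
        rw [if_pos h1, if_pos (by omega), ← Real.exp_add]
        congr 1
        rw [hh]
        ring
      have h2 := (sq_one_sub_exp_neg_le (mul_nonneg hμ.le hh0)).trans (min_le_right _ _)
      calc _ = ouKernel μ δ J' j ^ 2 * (1 - Real.exp (-(μ * h))) ^ 2 := by rw [e]; ring
        _ ≤ ouKernel μ δ J' j ^ 2 * (μ * h) := by gcongr
        _ = _ := by ring
    · have e1 : ouKernel μ δ J' j = 0 := if_neg (by omega)
      have e2 : ouKernel (2 * μ) δ J' j = 0 := if_neg (by omega)
      rw [e1, e2, sub_zero, mul_zero, zero_add, ouKernel_sq]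
      unfold ouKernel
      split_ifs with h3 h4 h4
      · refine Real.exp_le_one_iff.2 ?_
        have : (j : ℝ) < J := by exact_mod_cast h3
        have : 0 ≤ 2 * μ * ((J - j : ℝ) * δ) :=
          mul_nonneg (by linarith) (mul_nonneg (by linarith) hδ.le)
        linarith
      · omega
      · omega
      · exact le_rfl
  have hcount : ∑ j ∈ Finset.range N, (if J' ≤ j ∧ j < J then (1 : ℝ) else 0) ≤ J - J' := by
    rw [← Finset.sum_filter, Finset.sum_const, nsmul_eq_mul, mul_one, ← Nat.cast_sub hJ]
    have : (Finset.range N).filter (fun j => J' ≤ j ∧ j < J) ⊆ Finset.Ico J' J := by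
      intro j hj
      simpa using (Finset.mem_filter.1 hj).2
    have := Finset.card_le_card this
    rw [Nat.card_Ico] at this
    exact_mod_cast this
  calc _ ≤ (∑ j ∈ Finset.range N, (μ * h * ouKernel (2 * μ) δ J' j
          + if J' ≤ j ∧ j < J then 1 else 0)) * δ := by
        gcongr with j
        exact hterm j
    _ = μ * h * ((∑ j ∈ Finset.range N, ouKernel (2 * μ) δ J' j) * δ)
        + (∑ j ∈ Finset.range N, (if J' ≤ j ∧ j < J then (1 : ℝ) else 0)) * δ := by
        rw [Finset.sum_add_distrib, ← Finset.mul_sum]; ring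
    _ ≤ μ * h * (1 / (2 * μ)) + (J - J' : ℝ) * δ := by
        gcongr
        exact sum_ouKernel_le (by positivity) hδ J' N
    _ = 3 / 2 * h := by rw [← hh]; field_simp; ring
    _ ≤ 2 * h := by linarith

theorem sum_ouKernel_time_sub_sq_le {μ δ : ℝ} (hμ : 0 < μ) (hδ : 0 < δ) (J J' N : ℕ) :
    (∑ j ∈ Finset.range N, (ouKernel μ δ J j - ouKernel μ δ J' j) ^ 2) * δ
      ≤ 2 * |(J - J' : ℝ) * δ| := by
  rcases le_total J' J with h | h
  · exact (sum_ouKernel_time_sub_sq_le_of_le hμ hδ h N).trans (by gcongr; exact le_abs_self _)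
  · have h1 := sum_ouKernel_time_sub_sq_le_of_le hμ hδ h N
    have h2 : ∀ j, (ouKernel μ δ J j - ouKernel μ δ J' j) ^ 2
        = (ouKernel μ δ J' j - ouKernel μ δ J j) ^ 2 := fun j => by ring
    simp only [h2]
    refine h1.trans ?_
    gcongr
    rw [← abs_neg]
    refine le_trans (le_of_eq ?_) (le_abs_self _)
    ring

/-- The weight of the `j`-th noise increment in the Riemann sum for the combination
`c (X (t) - Y (t)) - d (X (s) - Y (s))`, where `X` and `Y` are Ornstein-Uhlenbeck processes of rates
`a + b` and `a`, and `J`, `J'` are the indices of the grid points `t`, `s`. -/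
noncomputable def ouIncrementKernel (a b δ c d : ℝ) (J J' j : ℕ) : ℝ :=
  c * (ouKernel (a + b) δ J j - ouKernel a δ J j)
    - d * (ouKernel (a + b) δ J' j - ouKernel a δ J' j)

theorem sum_ouIncrementKernel_sq_le_rpow {a b δ p c d : ℝ} (ha : 0 < a) (hb : 0 ≤ b) (hδ : 0 < δ)
    (hp0 : 0 ≤ p) (hp1 : p ≤ 1) (hc : |c| ≤ 1) (hd : |d| ≤ 1) (J J' N : ℕ) :
    (∑ j ∈ Finset.range N, ouIncrementKernel a b δ c d J J' j ^ 2) * δ ≤ 4 * ((b / a) ^ p / a) := by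
  have hc2 : c ^ 2 ≤ 1 := (sq_le_one_iff_abs_le_one c).2 hc
  have hd2 : d ^ 2 ≤ 1 := (sq_le_one_iff_abs_le_one d).2 hd
  have hterm : ∀ j, ouIncrementKernel a b δ c d J J' j ^ 2
      ≤ 2 * (ouKernel (a + b) δ J j - ouKernel a δ J j) ^ 2
        + 2 * (ouKernel (a + b) δ J' j - ouKernel a δ J' j) ^ 2 := fun j => by
    unfold ouIncrementKernel
    set u := ouKernel (a + b) δ J j - ouKernel a δ J j
    set v := ouKernel (a + b) δ J' j - ouKernel a δ J' j
    nlinarith [sq_nonneg (c * u + d * v), sq_nonneg u, sq_nonneg v,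
      mul_nonneg (sub_nonneg.2 hc2) (sq_nonneg u), mul_nonneg (sub_nonneg.2 hd2) (sq_nonneg v)]
  calc _ ≤ (∑ j ∈ Finset.range N, (2 * (ouKernel (a + b) δ J j - ouKernel a δ J j) ^ 2
        + 2 * (ouKernel (a + b) δ J' j - ouKernel a δ J' j) ^ 2)) * δ := by
        gcongr with j
        exact hterm j
    _ = 2 * ((∑ j ∈ Finset.range N, (ouKernel (a + b) δ J j - ouKernel a δ J j) ^ 2) * δ)
        + 2 * ((∑ j ∈ Finset.range N, (ouKernel (a + b) δ J' j - ouKernel a δ J' j) ^ 2) * δ) := by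
        rw [Finset.sum_add_distrib, ← Finset.mul_sum, ← Finset.mul_sum]; ring
    _ ≤ 2 * ((b / a) ^ p / a) + 2 * ((b / a) ^ p / a) := by
        gcongr <;> exact sum_ouKernel_sub_sq_le ha hb hδ hp0 hp1 _ N
    _ = _ := by ring

theorem sum_ouIncrementKernel_sq_le_dist {a b δ c d : ℝ} (ha : 0 < a) (hb : 0 ≤ b) (hδ : 0 < δ)
    (hc : |c| ≤ 1) (J J' N : ℕ) :
    (∑ j ∈ Finset.range N, ouIncrementKernel a b δ c d J J' j ^ 2) * δ
      ≤ 16 * |(J - J' : ℝ) * δ| + 2 * (c - d) ^ 2 / a := by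
  have hc2 : c ^ 2 ≤ 1 := (sq_le_one_iff_abs_le_one c).2 hc
  have hterm : ∀ j, ouIncrementKernel a b δ c d J J' j ^ 2
      ≤ 4 * (ouKernel (a + b) δ J j - ouKernel (a + b) δ J' j) ^ 2
        + 4 * (ouKernel a δ J j - ouKernel a δ J' j) ^ 2
        + 2 * (c - d) ^ 2 * (ouKernel (a + b) δ J' j - ouKernel a δ J' j) ^ 2 := fun j => by
    unfold ouIncrementKernel
    set u := ouKernel (a + b) δ J j
    set v := ouKernel a δ J j
    set u' := ouKernel (a + b) δ J' j
    set v' := ouKernel a δ J' j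
    nlinarith [sq_nonneg (c * (u - v - u' + v') - (c - d) * (u' - v')),
      sq_nonneg ((u - u') + (v - v')),
      mul_nonneg (sub_nonneg.2 hc2) (sq_nonneg (u - v - u' + v'))]
  have h0 : (∑ j ∈ Finset.range N, (ouKernel (a + b) δ J' j - ouKernel a δ J' j) ^ 2) * δ
      ≤ 1 / a := by
    simpa using sum_ouKernel_sub_sq_le (p := 0) ha hb hδ le_rfl zero_le_one J' N
  calc _ ≤ (∑ j ∈ Finset.range N, (4 * (ouKernel (a + b) δ J j - ouKernel (a + b) δ J' j) ^ 2
        + 4 * (ouKernel a δ J j - ouKernel a δ J' j) ^ 2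
        + 2 * (c - d) ^ 2 * (ouKernel (a + b) δ J' j - ouKernel a δ J' j) ^ 2)) * δ := by
        gcongr with j
        exact hterm j
    _ = 4 * ((∑ j ∈ Finset.range N, (ouKernel (a + b) δ J j - ouKernel (a + b) δ J' j) ^ 2) * δ)
        + 4 * ((∑ j ∈ Finset.range N, (ouKernel a δ J j - ouKernel a δ J' j) ^ 2) * δ)
        + 2 * (c - d) ^ 2 *
          ((∑ j ∈ Finset.range N, (ouKernel (a + b) δ J' j - ouKernel a δ J' j) ^ 2) * δ) := by
        rw [Finset.sum_add_distrib, Finset.sum_add_distrib, ← Finset.mul_sum, ← Finset.mul_sum,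
          ← Finset.mul_sum]
        ring
    _ ≤ 4 * (2 * |(J - J' : ℝ) * δ|) + 4 * (2 * |(J - J' : ℝ) * δ|)
        + 2 * (c - d) ^ 2 * (1 / a) := by
        have h1 := sum_ouKernel_time_sub_sq_le (μ := a + b) (by positivity) hδ J J' N
        have h2 := sum_ouKernel_time_sub_sq_le ha hδ J J' N
        have h3 := mul_le_mul_of_nonneg_left h0 (by positivity : 0 ≤ 2 * (c - d) ^ 2)
        linarith
    _ = _ := by ring

theorem le_rpow_mul_rpow_of_le_of_le {A x y θ : ℝ} (hA : 0 ≤ A) (hθ0 : 0 ≤ θ) (hθ1 : θ ≤ 1)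
    (hx : A ≤ x) (hy : A ≤ y) : A ≤ x ^ (1 - θ) * y ^ θ := by
  rcases hA.eq_or_lt with rfl | hA
  · positivity
  calc A = A ^ (1 - θ) * A ^ θ := by rw [← Real.rpow_add hA]; simp
    _ ≤ _ := by
      have : 0 ≤ x := hA.le.trans hx
      gcongr

theorem mode_ratio_rpow_le {ν ε p : ℝ} (hν : 0 < ν) (hε : 0 < ε) (hp0 : 0 < p) (k : ℤ) :
    ((ε ^ 2 * (k : ℝ) ^ 4) / (ν * (k : ℝ) ^ 2 + 1)) ^ p / (ν * (k : ℝ) ^ 2 + 1)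
      ≤ ν ^ (-(p + 1)) * (ε ^ (2 * p) * |(k : ℝ)| ^ (2 * p - 2)) := by
  rcases eq_or_ne k 0 with rfl | hk
  · simp [Real.zero_rpow hp0.ne']
    positivity
  · have hk0 : (0 : ℝ) < |(k : ℝ)| := by simpa using hk
    set x := |(k : ℝ)| with hx
    have h2 : (k : ℝ) ^ 2 = x ^ 2 := by rw [hx, sq_abs]
    have h4 : (k : ℝ) ^ 4 = x ^ 4 := by
      rw [show (k : ℝ) ^ 4 = ((k : ℝ) ^ 2) ^ 2 by ring, h2]; ring
    rw [h2, h4]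
    calc _ ≤ ((ε ^ 2 * x ^ 4) / (ν * x ^ 2)) ^ p / (ν * x ^ 2) := by
          gcongr <;> linarith
      _ = (ε ^ 2 * x ^ 2 / ν) ^ p / (ν * x ^ 2) := by
          congr 2; field_simp
      _ = _ := by
          rw [Real.div_rpow (by positivity) hν.le, Real.mul_rpow (by positivity) (by positivity),
            ← Real.rpow_natCast ε 2, ← Real.rpow_natCast x 2, ← Real.rpow_mul hε.le,
            ← Real.rpow_mul hk0.le, Real.rpow_neg hν.le, Real.rpow_add hν, Real.rpow_one,
            Real.rpow_sub hk0]
          push_cast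
          rw [Real.rpow_two x]
          field_simp

end Kernel

section Fourier

/-- The normalised real trigonometric functions `(cos (k x) + sin (k x)) / √(2π)`, `k ∈ ℤ`. -/
noncomputable def cas (k : ℤ) (x : ℝ) : ℝ :=
  (Real.cos (k * x) + Real.sin (k * x)) / Real.sqrt (2 * Real.pi)

theorem two_le_sqrt_two_pi : 2 ≤ Real.sqrt (2 * Real.pi) :=
  Real.le_sqrt_of_sq_le (by nlinarith [Real.pi_gt_three])

theorem abs_cas_le_one (k : ℤ) (x : ℝ) : |cas k x| ≤ 1 := by
  unfold cas
  rw [abs_div, abs_of_pos (lt_of_lt_of_le two_pos two_le_sqrt_two_pi),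
    div_le_one (lt_of_lt_of_le two_pos two_le_sqrt_two_pi)]
  refine (abs_add_le _ _).trans ?_
  linarith [Real.abs_cos_le_one (k * x), Real.abs_sin_le_one (k * x), two_le_sqrt_two_pi]

theorem abs_cas_sub_le (k : ℤ) (x y : ℝ) : |cas k x - cas k y| ≤ |(k : ℝ)| * |x - y| := by
  unfold cas
  have hpos := lt_of_lt_of_le two_pos two_le_sqrt_two_pi
  rw [← sub_div, abs_div, abs_of_pos hpos, div_le_iff₀ hpos, ← abs_mul, mul_sub]
  have h1 := Real.abs_cos_sub_cos_le (k * x) (k * y)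
  have h2 := Real.abs_sin_sub_sin_le (k * x) (k * y)
  have h3 : Real.cos (k * x) + Real.sin (k * x) - (Real.cos (k * y) + Real.sin (k * y))
      = (Real.cos (k * x) - Real.cos (k * y)) + (Real.sin (k * x) - Real.sin (k * y)) := by ring
  rw [h3]
  refine (abs_add_le _ _).trans ?_
  nlinarith [two_le_sqrt_two_pi, abs_nonneg ((k : ℝ) * x - k * y)]

theorem contDiff_cas (k : ℤ) {m : WithTop ℕ∞} : ContDiff ℝ m (cas k) := by
  unfold cas
  fun_prop

theorem continuous_cas (k : ℤ) : Continuous (cas k) := (contDiff_cas k (m := 0)).continuous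

theorem iteratedDeriv_two_cas (k : ℤ) : iteratedDeriv 2 (cas k) = fun x => -(k : ℝ) ^ 2 * cas k x := by
  have hd : ∀ x : ℝ, HasDerivAt (fun x : ℝ => (k : ℝ) * x) k x := fun x => by
    simpa using (hasDerivAt_id' x).const_mul (k : ℝ)
  have h1 : deriv (cas k) = fun x =>
      (-Real.sin (k * x) * k + Real.cos (k * x) * k) / Real.sqrt (2 * Real.pi) := by
    funext x
    exact (((hd x).cos.fun_add (hd x).sin).div_const _).deriv
  rw [iteratedDeriv_succ, iteratedDeriv_one, h1]
  funext x
  refine (((((hd x).sin.fun_neg.mul_const _).fun_add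
    ((hd x).cos.mul_const _)).div_const _).deriv).trans ?_
  unfold cas
  ring

variable {n : ℕ}

theorem iteratedDeriv_two_cas_smul (k : ℤ) (v : EuclideanSpace ℝ (Fin n)) :
    iteratedDeriv 2 (fun x => cas k x • v) = fun x => (-(k : ℝ) ^ 2) • (cas k x • v) := by
  have hdiff : Differentiable ℝ (cas k) := (contDiff_cas k (m := 1)).differentiable (by norm_num)
  have hdiff' : Differentiable ℝ (deriv (cas k)) :=
    ((contDiff_cas k (m := 2)).iterate_deriv' 1 1).differentiable (by norm_num)
  have h1 : deriv (fun x => cas k x • v) = fun x => deriv (cas k) x • v := by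
    funext x
    exact ((hdiff x).hasDerivAt.smul_const v).deriv
  rw [iteratedDeriv_succ, iteratedDeriv_one, h1]
  funext x
  rw [((hdiff' x).hasDerivAt.smul_const v).deriv]
  have := congrFun (iteratedDeriv_two_cas k) x
  rw [iteratedDeriv_succ, iteratedDeriv_one] at this
  rw [this, smul_smul]

/-- The vector-valued test function `cas k • e_c`. -/
noncomputable def casTest (n : ℕ) (i : ℤ × Fin n) : PeriodicTest n where
  toFun x := cas i.1 x • EuclideanSpace.single i.2 (1 : ℝ)
  smooth := (contDiff_cas i.1).smul contDiff_const
  periodic x := by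
    have h : (i.1 : ℝ) * (x + 2 * Real.pi) = i.1 * x + i.1 * (2 * Real.pi) := by ring
    simp only [cas, h, Real.cos_add_int_mul_two_pi, Real.sin_add_int_mul_two_pi]

/-- The rate of decay `ν k² + 1 + ε² k⁴` of the `k`-th Fourier mode. -/
noncomputable def modeRate (ν ε : ℝ) (k : ℤ) : ℝ := ν * k ^ 2 + 1 + ε ^ 2 * k ^ 4

theorem modeRate_pos {ν : ℝ} (hν : 0 < ν) (ε : ℝ) (k : ℤ) : 0 < modeRate ν ε k := by
  unfold modeRate
  positivity

theorem linOp_casTest_apply (ν ε : ℝ) (i : ℤ × Fin n) (x : ℝ) :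
    ((casTest n i).linOp ν ε).toFun x = (-modeRate ν ε i.1) • (casTest n i).toFun x := by
  have h2 := iteratedDeriv_two_cas_smul i.1 (EuclideanSpace.single i.2 (1 : ℝ))
  have h4 : iteratedDeriv 4 (casTest n i).toFun
      = fun x => ((i.1 : ℝ) ^ 4) • (casTest n i).toFun x := by
    have : iteratedDeriv 4 (casTest n i).toFun
        = iteratedDeriv 2 (iteratedDeriv 2 (casTest n i).toFun) := by
      simp only [iteratedDeriv_eq_iterate]
      rfl
    rw [this]
    change iteratedDeriv 2 (iteratedDeriv 2
      (fun x => cas i.1 x • EuclideanSpace.single i.2 (1 : ℝ))) = _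
    rw [h2]
    funext x
    rw [iteratedDeriv_fun_const_smul_field, h2, smul_smul]
    congr 1
    ring
  change ν • iteratedDeriv 2 (fun x => cas i.1 x • EuclideanSpace.single i.2 (1 : ℝ)) x
    - (casTest n i).toFun x - ε ^ 2 • iteratedDeriv 4 (casTest n i).toFun x = _
  rw [h4, h2]
  change ν • (-(i.1 : ℝ) ^ 2) • (casTest n i).toFun x - (casTest n i).toFun x
    - ε ^ 2 • (i.1 : ℝ) ^ 4 • (casTest n i).toFun x = _
  unfold modeRate
  module

theorem toL2_linOp_casTest (ν ε : ℝ) (i : ℤ × Fin n) :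
    ((casTest n i).linOp ν ε).toL2 = (-modeRate ν ε i.1) • (casTest n i).toL2 := by
  unfold PeriodicTest.toL2
  rw [← MemLp.toLp_const_smul]
  exact MemLp.toLp_congr _ _ (ae_of_all _ fun x => linOp_casTest_apply ν ε i x)

theorem integral_cos_int_mul (m : ℤ) :
    ∫ x in (0 : ℝ)..(2 * Real.pi), Real.cos (m * x) = if m = 0 then 2 * Real.pi else 0 := by
  split_ifs with h
  · simp [h]
  · have hm : (m : ℝ) ≠ 0 := by exact_mod_cast h
    rw [intervalIntegral.integral_comp_mul_left (fun x => Real.cos x) hm]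
    have h0 : Real.sin (m * (2 * Real.pi)) = 0 := by
      rw [← Real.sin_int_mul_pi (2 * m)]
      push_cast
      ring_nf
    simp [h0]

theorem integral_sin_int_mul (m : ℤ) :
    ∫ x in (0 : ℝ)..(2 * Real.pi), Real.sin (m * x) = 0 := by
  by_cases h : m = 0
  · simp [h]
  · have hm : (m : ℝ) ≠ 0 := by exact_mod_cast h
    rw [intervalIntegral.integral_comp_mul_left (fun x => Real.sin x) hm]
    simp [Real.cos_int_mul_two_pi]

theorem integral_cas_mul_cas (k l : ℤ) :
    ∫ x in Set.Icc (0 : ℝ) (2 * Real.pi), cas k x * cas l x = if k = l then 1 else 0 := by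
  rw [integral_Icc_eq_integral_Ioc, ← intervalIntegral.integral_of_le (by positivity)]
  have hs : Real.sqrt (2 * Real.pi) ^ 2 = 2 * Real.pi := Real.sq_sqrt (by positivity)
  have h : ∀ x, cas k x * cas l x
      = (Real.cos ((k - l : ℤ) * x) + Real.sin ((k + l : ℤ) * x)) / (2 * Real.pi) := fun x => by
    unfold cas
    rw [div_mul_div_comm, ← sq, hs]
    push_cast
    rw [sub_mul, add_mul (k : ℝ) l x, Real.cos_sub, Real.sin_add]
    ring
  simp only [h]
  rw [intervalIntegral.integral_div, intervalIntegral.integral_add, integral_cos_int_mul,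
    integral_sin_int_mul]
  · simp only [sub_eq_zero, add_zero]
    split_ifs
    · field_simp
    · simp
  all_goals apply Continuous.intervalIntegrable; fun_prop

theorem casTest_coeFn (i : ℤ × Fin n) :
    ((casTest n i).toL2 : ℝ → EuclideanSpace ℝ (Fin n))
      =ᵐ[volume.restrict (Set.Icc (0 : ℝ) (2 * Real.pi))]
        fun x => cas i.1 x • EuclideanSpace.single i.2 (1 : ℝ) :=
  MemLp.coeFn_toLp _

theorem inner_casTest_toL2 (i : ℤ × Fin n) (v : PeriodicL2 n) :
    inner ℝ (casTest n i).toL2 v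
      = ∫ x in Set.Icc (0 : ℝ) (2 * Real.pi), cas i.1 x * v x i.2 := by
  rw [L2.inner_def]
  refine integral_congr_ae ?_
  filter_upwards [casTest_coeFn i] with x hx
  rw [hx, real_inner_smul_left, EuclideanSpace.inner_single_left]
  simp

theorem orthonormal_casTest : Orthonormal ℝ fun i : ℤ × Fin n => (casTest n i).toL2 := by
  classical
  rw [orthonormal_iff_ite]
  rintro ⟨k, c⟩ ⟨l, d⟩
  rw [inner_casTest_toL2]
  have : ∫ x in Set.Icc (0 : ℝ) (2 * Real.pi), cas k x * ((casTest n (l, d)).toL2 x) c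
      = ∫ x in Set.Icc (0 : ℝ) (2 * Real.pi), (cas k x * cas l x) * if c = d then 1 else 0 := by
    refine integral_congr_ae ?_
    filter_upwards [casTest_coeFn (l, d)] with x hx
    rw [hx]
    simp
  rw [this, integral_mul_const, integral_cas_mul_cas]
  simp only [Prod.mk.injEq]
  split_ifs <;> simp_all

theorem memLp_apply (v : PeriodicL2 n) (c : Fin n) :
    MemLp (fun x => v x c) 2 (volume.restrict (Set.Icc (0 : ℝ) (2 * Real.pi))) :=
  (EuclideanSpace.proj c : EuclideanSpace ℝ (Fin n) →L[ℝ] ℝ).comp_memLp' (Lp.memLp v)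

theorem eq_zero_of_inner_casTest_eq_zero (v : PeriodicL2 n)
    (hv : ∀ i, inner ℝ (casTest n i).toL2 v = 0) : v = 0 := by
  have hπ : (0 : ℝ) < 2 * Real.pi := by positivity
  have hcomp : ∀ c : Fin n,
      ∀ᵐ x ∂volume.restrict (Set.Icc (0 : ℝ) (2 * Real.pi)), v x c = 0 := by
    intro c
    have hm := memLp_apply v c
    have hint : ∀ g : ℝ → ℝ, Continuous g →
        IntegrableOn (fun x => g x * v x c) (Set.Icc (0 : ℝ) (2 * Real.pi)) := fun g hg => by
      refine IntegrableOn.continuousOn_mul hg.continuousOn (hm.integrable (by norm_num)) isCompact_Icc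
    have hcas : ∀ k : ℤ, ∫ x in Set.Icc (0 : ℝ) (2 * Real.pi), cas k x * v x c = 0 := fun k => by
      exact (inner_casTest_toL2 (k, c) v).symm.trans (hv (k, c))
    have hsq : Real.sqrt (2 * Real.pi) ≠ 0 := (lt_of_lt_of_le two_pos two_le_sqrt_two_pi).ne'
    have hcos : ∀ k : ℤ, ∫ x in Set.Icc (0 : ℝ) (2 * Real.pi), Real.cos (k * x) * v x c = 0 := by
      intro k
      have : ∀ x, Real.cos (k * x) * v x c = Real.sqrt (2 * Real.pi) / 2 *
          (cas k x * v x c + cas (-k) x * v x c) := fun x => by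
        unfold cas
        push_cast
        rw [neg_mul, Real.cos_neg, Real.sin_neg]
        field_simp
        ring
      simp only [this]
      rw [integral_const_mul, integral_add (hint _ (continuous_cas _)) (hint _ (continuous_cas _)),
        hcas, hcas]
      simp
    have hsin : ∀ k : ℤ, ∫ x in Set.Icc (0 : ℝ) (2 * Real.pi), Real.sin (k * x) * v x c = 0 := by
      intro k
      have : ∀ x, Real.sin (k * x) * v x c = Real.sqrt (2 * Real.pi) / 2 *
          (cas k x * v x c - cas (-k) x * v x c) := fun x => by
        unfold cas
        push_cast
        rw [neg_mul, Real.cos_neg, Real.sin_neg]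
        field_simp
        ring
      simp only [this]
      rw [integral_const_mul, integral_sub (hint _ (continuous_cas _)) (hint _ (continuous_cas _)),
        hcas, hcas]
      simp
    set f : ℝ → ℂ := fun x => (v x c : ℂ) with hf
    have hfm : MemLp f 2 (volume.restrict (Set.Ioc (0 : ℝ) (2 * Real.pi))) := by
      rw [restrict_Ioc_eq_restrict_Icc]
      exact hm.ofReal
    have hcoef : ∀ m : ℤ, fourierCoeffOn hπ f m = 0 := fun m => by
      rw [fourierCoeffOn_eq_integral, intervalIntegral.integral_of_le hπ.le,
        ← integral_Icc_eq_integral_Ioc]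
      have : ∀ x : ℝ, (fourier (-m) : C(AddCircle (2 * Real.pi - 0), ℂ)) (x : AddCircle _) • f x
          = ((Real.cos (m * x) * v x c : ℝ) : ℂ)
            - Complex.I * ((Real.sin (m * x) * v x c : ℝ) : ℂ) := fun x => by
        rw [fourier_coe_apply, smul_eq_mul]
        have e : 2 * (Real.pi : ℂ) * Complex.I * ((-m : ℤ) : ℂ) * (x : ℂ)
            / ((2 * Real.pi - 0 : ℝ) : ℂ) = ((-(m * x) : ℝ) : ℂ) * Complex.I := by
          have : (Real.pi : ℂ) ≠ 0 := by exact_mod_cast Real.pi_ne_zero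
          push_cast
          rw [sub_zero]
          field_simp
        rw [e, Complex.exp_mul_I, ← Complex.ofReal_cos, ← Complex.ofReal_sin, Real.cos_neg,
          Real.sin_neg]
        push_cast
        ring
      simp only [this]
      rw [integral_sub, integral_const_mul, integral_complex_ofReal, integral_complex_ofReal,
        hcos, hsin]
      · simp
      · exact (hint _ (by fun_prop)).ofReal
      · exact ((hint _ (by fun_prop)).ofReal).const_mul _
    have hpars := (tsum_sq_fourierCoeffOn hπ hfm).symm
    simp only [hcoef, norm_zero, ne_eq, OfNat.ofNat_ne_zero, not_false_eq_true, zero_pow, tsum_zero,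
      sub_zero, smul_eq_mul] at hpars
    have h0 : ∫ x in (0 : ℝ)..(2 * Real.pi), ‖f x‖ ^ 2 = 0 := by
      rcases mul_eq_zero.1 hpars with h | h
      · exact absurd (inv_eq_zero.1 h) hπ.ne'
      · exact h
    rw [intervalIntegral.integral_of_le hπ.le, ← integral_Icc_eq_integral_Ioc,
      integral_eq_zero_iff_of_nonneg (fun x => by positivity)] at h0
    · filter_upwards [h0] with x hx
      simpa [hf] using hx
    · rw [restrict_Ioc_eq_restrict_Icc] at hfm
      exact (memLp_two_iff_integrable_sq_norm hfm.1).1 hfm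
  refine Lp.ext ?_
  have hall := ae_all_iff.2 hcomp
  filter_upwards [hall, Lp.coeFn_zero (EuclideanSpace ℝ (Fin n)) 2
    (volume.restrict (Set.Icc (0 : ℝ) (2 * Real.pi)))] with x hx h0
  rw [h0]
  ext c
  simpa using hx c

open Filter Topology in
theorem tendsto_sum_inner_casTest (v : PeriodicL2 n) :
    Tendsto (fun N : ℕ => ∑ c : Fin n, ∑ k ∈ Finset.Icc (-(N : ℤ)) N,
      inner ℝ v (casTest n (k, c)).toL2 • (casTest n (k, c)).toL2) atTop (𝓝 v) := by
  have hbot : (Submodule.span ℝ (Set.range fun i : ℤ × Fin n => (casTest n i).toL2))ᗮ = ⊥ := by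
    rw [Submodule.eq_bot_iff]
    intro v hv
    refine eq_zero_of_inner_casTest_eq_zero v fun i => ?_
    exact (Submodule.mem_orthogonal _ _).1 hv _ (Submodule.subset_span ⟨i, rfl⟩)
  set b := HilbertBasis.mkOfOrthogonalEqBot (orthonormal_casTest (n := n)) hbot with hb
  have hbi : ∀ i, b i = (casTest n i).toL2 := fun i => by
    rw [hb, HilbertBasis.coe_mkOfOrthogonalEqBot]
  have hsum := b.hasSum_repr v
  have hlim : Tendsto (fun N : ℕ => Finset.Icc (-(N : ℤ)) N ×ˢ (Finset.univ : Finset (Fin n)))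
      atTop atTop := by
    refine tendsto_atTop_finset_of_monotone (fun N M h => ?_) fun i => ⟨i.1.natAbs, ?_⟩
    · refine Finset.product_subset_product_left (Finset.Icc_subset_Icc ?_ ?_) <;> omega
    · simp only [Finset.mem_product, Finset.mem_Icc, Finset.mem_univ, and_true]
      omega
  refine (hsum.comp hlim).congr fun N => ?_
  simp only [Function.comp, Finset.sum_product_right, b.repr_apply_apply, hbi, real_inner_comm]

end Fourier

section EssSup

open Filter Topology

variable {α E : Type*} [MeasurableSpace α] {μ : Measure α} [NormedAddCommGroup E]

theorem isClosed_setOf_eLpNorm_top_le (p : ℝ≥0∞) [Fact (1 ≤ p)] (c : ℝ≥0∞) :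
    IsClosed {v : Lp E p μ | eLpNorm v ⊤ μ ≤ c} := by
  refine IsSeqClosed.isClosed fun v w hv hw => ?_
  obtain ⟨ns, -, hns⟩ := (tendstoInMeasure_of_tendsto_Lp hw).exists_seq_tendsto_ae
  refine (Lp.eLpNorm_exponent_top_lim_le_liminf_eLpNorm_exponent_top hns).trans ?_
  refine (liminf_le_liminf (Eventually.of_forall fun i => hv (ns i))).trans ?_
  simp

theorem lowerSemicontinuous_eLpNorm_top (p : ℝ≥0∞) [Fact (1 ≤ p)] :
    LowerSemicontinuous fun v : Lp E p μ => eLpNorm v ⊤ μ :=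
  lowerSemicontinuous_iff_isClosed_preimage.2 fun c => isClosed_setOf_eLpNorm_top_le p c

end EssSup

section Chaining

open Filter Topology

variable {Ω : Type*} [MeasurableSpace Ω] {P : Measure Ω}

theorem abs_le_mul_sum_exp_add_log {ι : Type*} (s : Finset ι) (f : ι → ℝ) {σ : ℝ} (hσ : 0 < σ)
    {i : ι} (hi : i ∈ s) :
    |f i| ≤ σ * ((∑ j ∈ s, (Real.exp (σ⁻¹ * f j) + Real.exp (-σ⁻¹ * f j))) / s.card
      + Real.log s.card) := by
  have hcard : (0 : ℝ) < s.card := by exact_mod_cast Finset.card_pos.2 ⟨i, hi⟩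
  have h1 : Real.exp (σ⁻¹ * |f i|) ≤ ∑ j ∈ s, (Real.exp (σ⁻¹ * f j) + Real.exp (-σ⁻¹ * f j)) := by
    refine le_trans ?_ (Finset.single_le_sum
      (f := fun j => Real.exp (σ⁻¹ * f j) + Real.exp (-σ⁻¹ * f j)) (fun j _ => by positivity) hi)
    rcases abs_cases (f i) with ⟨h, -⟩ | ⟨h, -⟩ <;> rw [h]
    · linarith [Real.exp_pos (-σ⁻¹ * f i)]
    · rw [mul_neg, ← neg_mul]
      linarith [Real.exp_pos (σ⁻¹ * f i)]
  have h2 := Real.add_one_le_exp (σ⁻¹ * |f i| - Real.log s.card)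
  rw [Real.exp_sub, Real.exp_log hcard] at h2
  have h3 : σ⁻¹ * |f i| ≤ (∑ j ∈ s, (Real.exp (σ⁻¹ * f j) + Real.exp (-σ⁻¹ * f j))) / s.card
      + Real.log s.card := by
    have := div_le_div_of_nonneg_right h1 hcard.le
    linarith
  rwa [inv_mul_le_iff₀ hσ] at h3

/-- The increment, at level `m`, of a family indexed by dyadic grids with respect to the parent
grid point of the previous level. -/
def dyadicIncrement (F : ℕ → ℕ → ℕ → Ω → ℝ) : ℕ → ℕ → ℕ → Ω → ℝ
  | 0, i, j, ω => F 0 i j ω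
  | m + 1, i, j, ω => F (m + 1) i j ω - F m (i / 2) (j / 2) ω

theorem lintegral_iSup_dyadic_le {F : ℕ → ℕ → ℕ → Ω → ℝ} (hF : ∀ m i j, AEMeasurable (F m i j) P)
    {σ : ℕ → ℝ} (hσ : ∀ m, 0 < σ m)
    (hpos : ∀ m i j, i ≤ 2 ^ m → j ≤ 2 ^ m →
      ∫⁻ ω, ENNReal.ofReal (Real.exp ((σ m)⁻¹ * dyadicIncrement F m i j ω)) ∂P
        ≤ ENNReal.ofReal (Real.exp 1))
    (hneg : ∀ m i j, i ≤ 2 ^ m → j ≤ 2 ^ m →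
      ∫⁻ ω, ENNReal.ofReal (Real.exp (-(σ m)⁻¹ * dyadicIncrement F m i j ω)) ∂P
        ≤ ENNReal.ofReal (Real.exp 1))
    [IsProbabilityMeasure P] :
    ∫⁻ ω, ⨆ (m : ℕ) (i : ℕ) (j : ℕ) (_ : i ≤ 2 ^ m) (_ : j ≤ 2 ^ m), ENNReal.ofReal |F m i j ω| ∂P
      ≤ ∑' m : ℕ, ENNReal.ofReal (σ m * (2 * m + 8)) := by
  set D := dyadicIncrement F with hD
  have hDm : ∀ m i j, AEMeasurable (D m i j) P := fun m i j => by
    cases m with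
    | zero => exact hF 0 i j
    | succ m => exact (hF (m + 1) i j).sub (hF m (i / 2) (j / 2))
  set s : ℕ → Finset (ℕ × ℕ) := fun m => Finset.range (2 ^ m + 1) ×ˢ Finset.range (2 ^ m + 1) with hs
  have hmem : ∀ m i j, i ≤ 2 ^ m → j ≤ 2 ^ m → (i, j) ∈ s m := fun m i j hi hj => by
    simp only [hs, Finset.mem_product, Finset.mem_range]
    omega
  have hmem' : ∀ m p, p ∈ s m → p.1 ≤ 2 ^ m ∧ p.2 ≤ 2 ^ m := fun m p hp => by
    simp only [hs, Finset.mem_product, Finset.mem_range] at hp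
    omega
  have hcard : ∀ m, 0 < (s m).card := fun m => Finset.card_pos.2 ⟨(0, 0), hmem _ _ _ (by simp) (by simp)⟩
  have hlog : ∀ m, Real.log (s m).card ≤ 2 * m + 2 := fun m => by
    have h1 : ((s m).card : ℝ) = ((2 : ℝ) ^ m + 1) ^ 2 := by
      simp only [hs, Finset.card_product, Finset.card_range]
      push_cast
      ring
    rw [h1, Real.log_pow]
    have h2 : (2 : ℝ) ^ m + 1 ≤ 2 ^ (m + 1) := by
      rw [pow_succ]; linarith [one_le_pow₀ (one_le_two : (1 : ℝ) ≤ 2) (n := m)]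
    have h3 := Real.log_le_log (by positivity) h2
    rw [Real.log_pow] at h3
    push_cast at h3 ⊢
    have h4 : Real.log 2 ≤ 1 := by linarith [Real.log_two_lt_d9]
    nlinarith [(Nat.cast_nonneg m : (0 : ℝ) ≤ m)]
  have hlog0 : ∀ m, 0 ≤ Real.log (s m).card := fun m =>
    Real.log_nonneg (by exact_mod_cast hcard m)
  set U : ℕ → Ω → ℝ := fun m ω => σ m * ((∑ p ∈ s m, (Real.exp ((σ m)⁻¹ * D m p.1 p.2 ω)
    + Real.exp (-(σ m)⁻¹ * D m p.1 p.2 ω))) / (s m).card + Real.log (s m).card) with hU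
  have hDU : ∀ m i j, i ≤ 2 ^ m → j ≤ 2 ^ m → ∀ ω, |D m i j ω| ≤ U m ω := fun m i j hi hj ω =>
    abs_le_mul_sum_exp_add_log (s m) (fun p => D m p.1 p.2 ω) (hσ m) (hmem m i j hi hj)
  have hU0 : ∀ m ω, 0 ≤ U m ω := fun m ω => by
    have := hlog0 m
    have := hσ m
    positivity
  have hFU : ∀ m i j, i ≤ 2 ^ m → j ≤ 2 ^ m → ∀ ω,
      |F m i j ω| ≤ ∑ l ∈ Finset.range (m + 1), U l ω := by
    intro m
    induction m with
    | zero => intro i j hi hj ω; rw [zero_add, Finset.sum_range_one]; exact hDU 0 i j hi hj ω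
    | succ m ih =>
      intro i j hi hj ω
      rw [pow_succ] at hi hj
      have h1 := ih (i / 2) (j / 2) (by omega) (by omega) ω
      have h2 := hDU (m + 1) i j (by rw [pow_succ]; omega) (by rw [pow_succ]; omega) ω
      have h3 : F (m + 1) i j ω = F m (i / 2) (j / 2) ω + D (m + 1) i j ω := by
        simp [hD, dyadicIncrement]
      rw [Finset.sum_range_succ, h3]
      exact (abs_add_le _ _).trans (add_le_add h1 h2)
  have hexp : ∀ m i j (l : ℝ), AEMeasurable (fun ω => ENNReal.ofReal (Real.exp (l * D m i j ω))) P :=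
    fun m i j l => (Real.measurable_exp.comp_aemeasurable ((hDm m i j).const_mul l)).ennreal_ofReal
  have hUm : ∀ m, AEMeasurable (fun ω => ENNReal.ofReal (U m ω)) P := fun m => by
    refine AEMeasurable.ennreal_ofReal (AEMeasurable.const_mul (AEMeasurable.add_const
      (AEMeasurable.div_const (Finset.aemeasurable_fun_sum _ fun p _ => ?_) _) _) _)
    exact (Real.measurable_exp.comp_aemeasurable ((hDm m _ _).const_mul _)).add
      (Real.measurable_exp.comp_aemeasurable ((hDm m _ _).const_mul _))
  have hUint : ∀ m, ∫⁻ ω, ENNReal.ofReal (U m ω) ∂P ≤ ENNReal.ofReal (σ m * (2 * m + 8)) := by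
    intro m
    have hc : (0 : ℝ) < (s m).card := by exact_mod_cast hcard m
    have e1 : ∀ ω, ENNReal.ofReal (U m ω) = ENNReal.ofReal (σ m / (s m).card) *
        (∑ p ∈ s m, (ENNReal.ofReal (Real.exp ((σ m)⁻¹ * D m p.1 p.2 ω))
          + ENNReal.ofReal (Real.exp (-(σ m)⁻¹ * D m p.1 p.2 ω))))
        + ENNReal.ofReal (σ m * Real.log (s m).card) := fun ω => by
      have h1 : U m ω = σ m / (s m).card * (∑ p ∈ s m, (Real.exp ((σ m)⁻¹ * D m p.1 p.2 ω)
          + Real.exp (-(σ m)⁻¹ * D m p.1 p.2 ω))) + σ m * Real.log (s m).card := by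
        simp only [hU]; ring
      rw [h1, ENNReal.ofReal_add (by have := hσ m; positivity)
        (mul_nonneg (hσ m).le (hlog0 m)), ENNReal.ofReal_mul (by have := hσ m; positivity),
        ENNReal.ofReal_sum_of_nonneg (fun p _ => by positivity)]
      congr 3 with p
      rw [ENNReal.ofReal_add (by positivity) (by positivity)]
    have hsum : ∀ p : ℕ × ℕ, AEMeasurable (fun ω =>
        ENNReal.ofReal (Real.exp ((σ m)⁻¹ * D m p.1 p.2 ω))
          + ENNReal.ofReal (Real.exp (-(σ m)⁻¹ * D m p.1 p.2 ω))) P :=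
      fun p => (hexp _ _ _ _).add (hexp _ _ _ _)
    simp only [e1]
    rw [lintegral_add_right' _ aemeasurable_const, lintegral_const, measure_univ, mul_one,
      lintegral_const_mul'' _ (Finset.aemeasurable_fun_sum _ fun p _ => hsum p),
      lintegral_finsetSum' _ (fun p _ => hsum p)]
    have h2 : ∑ p ∈ s m, ∫⁻ ω, (ENNReal.ofReal (Real.exp ((σ m)⁻¹ * D m p.1 p.2 ω))
          + ENNReal.ofReal (Real.exp (-(σ m)⁻¹ * D m p.1 p.2 ω))) ∂P
        ≤ ENNReal.ofReal ((s m).card * 6) := by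
      calc _ ≤ ∑ p ∈ s m, ENNReal.ofReal 6 := by
            refine Finset.sum_le_sum fun p hp => ?_
            rw [lintegral_add_left' (hexp _ _ _ _)]
            have hp' := hmem' m p hp
            refine (add_le_add (hpos m p.1 p.2 hp'.1 hp'.2) (hneg m p.1 p.2 hp'.1 hp'.2)).trans ?_
            rw [← ENNReal.ofReal_add (by positivity) (by positivity)]
            refine ENNReal.ofReal_le_ofReal ?_
            linarith [Real.exp_one_lt_d9]
        _ = _ := by
            rw [Finset.sum_const, nsmul_eq_mul, ENNReal.ofReal_mul (by positivity),
              ENNReal.ofReal_natCast]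
    calc _ ≤ ENNReal.ofReal (σ m / (s m).card) * ENNReal.ofReal ((s m).card * 6)
          + ENNReal.ofReal (σ m * Real.log (s m).card) := by gcongr
      _ = ENNReal.ofReal (σ m * 6 + σ m * Real.log (s m).card) := by
          rw [← ENNReal.ofReal_mul (by have := hσ m; positivity),
            ← ENNReal.ofReal_add (by have := hσ m; positivity)
              (mul_nonneg (hσ m).le (hlog0 m))]
          congr 2
          field_simp
      _ ≤ _ := by
          refine ENNReal.ofReal_le_ofReal ?_
          rw [← mul_add]
          exact mul_le_mul_of_nonneg_left (by linarith [hlog m]) (hσ m).le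
  calc _ ≤ ∫⁻ ω, ∑' m, ENNReal.ofReal (U m ω) ∂P := by
        refine lintegral_mono fun ω => ?_
        simp only [iSup_le_iff]
        intro m i j hi hj
        refine (ENNReal.ofReal_le_ofReal (hFU m i j hi hj ω)).trans ?_
        rw [ENNReal.ofReal_sum_of_nonneg fun l _ => hU0 l ω]
        exact ENNReal.sum_le_tsum _
    _ = ∑' m, ∫⁻ ω, ENNReal.ofReal (U m ω) ∂P := lintegral_tsum hUm
    _ ≤ _ := ENNReal.tsum_le_tsum hUint

theorem exists_dyadic_tendsto {L t : ℝ} (hL : 0 < L) (ht0 : 0 ≤ t) (htL : t ≤ L) :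
    ∃ i : ℕ → ℕ, (∀ m, i m ≤ 2 ^ m) ∧
      Tendsto (fun m => (i m : ℝ) * (L / 2 ^ m)) atTop (𝓝 t) := by
  refine ⟨fun m => ⌊t / L * 2 ^ m⌋₊, fun m => ?_, ?_⟩
  · refine Nat.floor_le_of_le ?_
    push_cast
    exact mul_le_of_le_one_left (by positivity) (div_le_one_of_le₀ htL hL.le)
  · have h1 : Tendsto (fun x : ℝ => (⌊t / L * x⌋₊ : ℝ) / x) atTop (𝓝 (t / L)) :=
      tendsto_nat_floor_mul_div_atTop (by positivity)
    have h2 := (h1.comp (tendsto_pow_atTop_atTop_of_one_lt (one_lt_two : (1 : ℝ) < 2))).mul_const L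
    rw [div_mul_cancel₀ _ hL.ne'] at h2
    refine h2.congr fun m => ?_
    simp only [Function.comp]
    ring

theorem ofReal_abs_le_iSup_dyadic {G : ℝ → ℝ → ℝ} (hG : Continuous (Function.uncurry G))
    {L L' : ℝ} (hL : 0 < L) (hL' : 0 < L') {t x : ℝ} (ht : t ∈ Set.Icc 0 L)
    (hx : x ∈ Set.Icc 0 L') :
    ENNReal.ofReal |G t x| ≤ ⨆ (m : ℕ) (i : ℕ) (j : ℕ) (_ : i ≤ 2 ^ m) (_ : j ≤ 2 ^ m),
      ENNReal.ofReal |G (i * (L / 2 ^ m)) (j * (L' / 2 ^ m))| := by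
  obtain ⟨i, hi, hit⟩ := exists_dyadic_tendsto hL ht.1 ht.2
  obtain ⟨j, hj, hjx⟩ := exists_dyadic_tendsto hL' hx.1 hx.2
  have h1 := (hG.tendsto (t, x)).comp (hit.prodMk_nhds hjx)
  have h2 := (ENNReal.continuous_ofReal.tendsto _).comp h1.abs
  refine le_of_tendsto' h2 fun m => ?_
  refine le_iSup_of_le m (le_iSup_of_le (i m) (le_iSup_of_le (j m) ?_))
  exact le_iSup_of_le (hi m) (le_iSup_of_le (hj m) le_rfl)

end Chaining

section Modes

variable {n : ℕ} {Ω : Type*} [MeasurableSpace Ω] {P : Measure Ω} {W : ℝ → PeriodicL2 n → Ω → ℝ}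
  {ν ε : ℝ} {ψ ψε ψ0 : ℝ → Ω → PeriodicL2 n}

theorem IsStationarySolution.isOrnsteinUhlenbeck (hψ : IsStationarySolution P W ν ε ψ)
    (i : ℤ × Fin n) :
    IsOrnsteinUhlenbeck P (modeRate ν ε i.1) (fun t => W t (casTest n i).toL2)
      (fun t ω => inner ℝ (ψ t ω) (casTest n i).toL2) where
  aemeasurable t := ((hψ.measurable t).inner aestronglyMeasurable_const).aemeasurable
  continuous_paths := by
    filter_upwards [hψ.continuous_paths] with ω hω
    exact hω.inner continuous_const
  equation s t hst := by
    filter_upwards [hψ.weak_solution (casTest n i) s t hst] with ω hω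
    rw [hω, toL2_linOp_casTest]
    simp only [real_inner_smul_right]
    rw [intervalIntegral.integral_const_mul]
    ring
  stationary t := by
    have h := hψ.stationary t 1 (fun _ => 0) (fun _ => (casTest n i).toL2)
    simpa [Function.comp_def] using h.comp (measurable_pi_apply 0)

/-- The `i`-th Fourier coefficient of `ψ₁ - ψ₂` at time `t`. -/
noncomputable def coefDiff (ψ₁ ψ₂ : ℝ → Ω → PeriodicL2 n) (i : ℤ × Fin n) (t : ℝ) (ω : Ω) : ℝ :=
  inner ℝ (ψ₁ t ω) (casTest n i).toL2 - inner ℝ (ψ₂ t ω) (casTest n i).toL2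

theorem lintegral_exp_coefDiff_le (hν : 0 < ν) (hW : IsCylindricalWiener P W)
    (hψε : IsStationarySolution P W ν ε ψε) (hψ0 : IsStationarySolution P W ν 0 ψ0)
    {T : ℝ} (hT : 0 < T) (c : Fin n) (I : Finset ℤ) (M i i' : ℕ) (α β B : ℤ → ℝ)
    (hB : ∀ δ : ℝ, 0 < δ → ∀ J J' N : ℕ, ((J : ℝ) - J') * δ = ((i : ℝ) - i') * (T / 2 ^ M) →
      ∀ k ∈ I, (∑ j ∈ Finset.range N,
        ouIncrementKernel (ν * k ^ 2 + 1) (ε ^ 2 * k ^ 4) δ (α k) (β k) J J' j ^ 2) * δ ≤ B k)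
    (l : ℝ) :
    ∫⁻ ω, ENNReal.ofReal (Real.exp (l * ∑ k ∈ I, (α k * coefDiff ψε ψ0 (k, c) (i * (T / 2 ^ M)) ω
        - β k * coefDiff ψε ψ0 (k, c) (i' * (T / 2 ^ M)) ω))) ∂P
      ≤ ENNReal.ofReal (Real.exp (l ^ 2 * ∑ k ∈ I, B k)) := by
  have horth : Orthonormal ℝ fun k : I => (casTest n ((k : ℤ), c)).toL2 :=
    orthonormal_casTest.comp (fun k : I => ((k : ℤ), c)) fun k k' h =>
      Subtype.ext (Prod.ext_iff.1 h).1
  have h := lintegral_exp_ornsteinUhlenbeck_le hW (Q := Bool × Bool) horth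
    (μ := fun k q => modeRate ν (if q.1 then ε else 0) k)
    (fun k q => modeRate_pos hν _ _)
    (X := fun k q t ω => inner ℝ ((if q.1 then ψε else ψ0) t ω) (casTest n ((k : ℤ), c)).toL2)
    (by
      rintro k ⟨q | q, q'⟩
      · exact hψ0.isOrnsteinUhlenbeck ((k : ℤ), c)
      · exact hψε.isOrnsteinUhlenbeck ((k : ℤ), c))
    hT M (fun q => if q.2 then i else i')
    (fun k q => (if q.1 then 1 else -1) * (if q.2 then α k else -β k)) (fun k => B k)
    (by
      intro δ hδ J N hJ k
      have h1 := hB δ hδ (J (true, true)) (J (true, false)) N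
        (by simpa using hJ (true, true) (true, false)) k k.2
      have e1 : ∀ q₁, J (false, q₁) = J (true, q₁) := fun q₁ => by
        have := hJ (false, q₁) (true, q₁)
        simp only [sub_self, zero_mul, mul_eq_zero, hδ.ne', or_false, sub_eq_zero] at this
        exact_mod_cast this
      refine le_trans (le_of_eq ?_) h1
      congr 1
      refine Finset.sum_congr rfl fun j _ => ?_
      congr 1
      simp only [Fintype.sum_prod_type, Fintype.sum_bool, e1, ouIncrementKernel, modeRate]
      simp
      ring) l
  rw [Finset.sum_coe_sort I B] at h
  refine le_trans (le_of_eq ?_) h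
  refine lintegral_congr fun ω => ?_
  rw [← Finset.sum_coe_sort I]
  congr 3
  refine Finset.sum_congr rfl fun k _ => ?_
  simp only [Fintype.sum_prod_type, Fintype.sum_bool, coefDiff]
  simp
  ring

end Modes

section Bounds

variable {n : ℕ} {Ω : Type*} [MeasurableSpace Ω] {P : Measure Ω} {W : ℝ → PeriodicL2 n → Ω → ℝ}
  {ν ε : ℝ} {ψε ψ0 : ℝ → Ω → PeriodicL2 n}

/-- The constant in the bound for the variance of the `k`-th mode. -/
noncomputable def modeConst (ν T p θ : ℝ) : ℝ :=
  (4 * ν ^ (-(p + 1))) ^ (1 - θ) * (4 + 16 * T + 8 * Real.pi ^ 2 / ν) ^ θ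

theorem modeConst_nonneg {ν T : ℝ} (hν : 0 < ν) (hT : 0 < T) (p θ : ℝ) : 0 ≤ modeConst ν T p θ := by
  unfold modeConst
  positivity

theorem le_modeConst_mul {ν T p θ ε A ρ : ℝ} (hν : 0 < ν) (hT : 0 < T) (hp0 : 0 < p)
    (hθ0 : 0 ≤ θ) (hθ1 : θ ≤ 1) (hε : 0 < ε) (hA : 0 ≤ A) (hρ : 0 ≤ ρ) (k : ℤ)
    (h1 : A ≤ 4 * (((ε ^ 2 * (k : ℝ) ^ 4) / (ν * (k : ℝ) ^ 2 + 1)) ^ p / (ν * (k : ℝ) ^ 2 + 1)))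
    (h2 : A ≤ (4 + 16 * T + 8 * Real.pi ^ 2 / ν) * ρ) :
    A ≤ modeConst ν T p θ * (ε ^ (p * (1 - θ))) ^ 2 * ρ ^ θ * |(k : ℝ)| ^ (-((2 - 2 * p) * (1 - θ))) := by
  have h3 : A ≤ 4 * ν ^ (-(p + 1)) * (ε ^ (2 * p) * |(k : ℝ)| ^ (2 * p - 2)) := by
    have := mode_ratio_rpow_le hν hε hp0 k
    linarith
  refine (le_rpow_mul_rpow_of_le_of_le hA hθ0 hθ1 h3 h2).trans (le_of_eq ?_)
  have e1 : (ε ^ (2 * p)) ^ (1 - θ) = (ε ^ (p * (1 - θ))) ^ 2 := by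
    rw [← Real.rpow_mul hε.le, ← Real.rpow_mul_natCast hε.le]
    congr 1
    push_cast
    ring
  have e2 : (|(k : ℝ)| ^ (2 * p - 2)) ^ (1 - θ) = |(k : ℝ)| ^ (-((2 - 2 * p) * (1 - θ))) := by
    rw [← Real.rpow_mul (abs_nonneg _)]
    congr 1
    ring
  rw [Real.mul_rpow (x := 4 * ν ^ (-(p + 1))) (by positivity) (by positivity),
    Real.mul_rpow (x := ε ^ (2 * p)) (by positivity) (by positivity),
    Real.mul_rpow (x := 4 + 16 * T + 8 * Real.pi ^ 2 / ν) (by positivity) hρ, e1, e2, modeConst]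
  ring

/-- The variance proxy of a dyadic increment of level `m` is the square of
`incrementScale ν T p θ * ε ^ (p * (1 - θ)) * ((1 / 2) ^ (θ / 2)) ^ m`. -/
noncomputable def incrementScale (ν T p θ : ℝ) : ℝ :=
  Real.sqrt (modeConst ν T p θ * (∑' k : ℤ, |(k : ℝ)| ^ (-((2 - 2 * p) * (1 - θ)))) + 1)

theorem sum_mode_bound_le {ν T p θ : ℝ} (hν : 0 < ν) (hT : 0 < T) (hε : 0 < ε)
    (hq : 1 < (2 - 2 * p) * (1 - θ)) (m : ℕ) (I : Finset ℤ) :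
    ∑ k ∈ I, modeConst ν T p θ * (ε ^ (p * (1 - θ))) ^ 2 * ((1 / 2 : ℝ) ^ m) ^ θ
        * |(k : ℝ)| ^ (-((2 - 2 * p) * (1 - θ)))
      ≤ (incrementScale ν T p θ * ε ^ (p * (1 - θ)) * ((1 / 2 : ℝ) ^ (θ / 2)) ^ m) ^ 2 := by
  have hs := (Real.summable_abs_int_rpow hq).sum_le_tsum I fun k _ => by positivity
  have hZ : 0 ≤ ∑' k : ℤ, |(k : ℝ)| ^ (-((2 - 2 * p) * (1 - θ))) := tsum_nonneg fun k => by positivity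
  have hK := modeConst_nonneg hν hT p θ
  have e1 : (((1 / 2 : ℝ) ^ (θ / 2)) ^ m) ^ 2 = ((1 / 2 : ℝ) ^ m) ^ θ := by
    rw [← pow_mul, ← Real.rpow_mul_natCast (by norm_num), ← Real.rpow_natCast,
      ← Real.rpow_mul (by norm_num)]
    congr 1
    push_cast
    ring
  rw [← Finset.mul_sum, mul_pow, mul_pow, incrementScale, Real.sq_sqrt (by positivity), e1]
  have h0 : 0 ≤ (ε ^ (p * (1 - θ))) ^ 2 * ((1 / 2 : ℝ) ^ m) ^ θ := by positivity
  calc _ ≤ modeConst ν T p θ * (ε ^ (p * (1 - θ))) ^ 2 * ((1 / 2 : ℝ) ^ m) ^ θ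
        * ∑' k : ℤ, |(k : ℝ)| ^ (-((2 - 2 * p) * (1 - θ))) := by gcongr
    _ ≤ _ := by nlinarith

theorem natCast_sub_two_mul_half (i : ℕ) : |(i : ℝ) - (2 * (i / 2) : ℕ)| ≤ 1 := by
  have h1 : 2 * (i / 2) ≤ i := by omega
  have h2 : i ≤ 2 * (i / 2) + 1 := by omega
  have h1' : ((2 * (i / 2) : ℕ) : ℝ) ≤ i := by exact_mod_cast h1
  have h2' : (i : ℝ) ≤ (2 * (i / 2) : ℕ) + 1 := by exact_mod_cast h2
  rw [abs_le]
  constructor <;> linarith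

theorem half_natCast_mul (i m : ℕ) (L : ℝ) :
    ((i / 2 : ℕ) : ℝ) * (L / 2 ^ m) = ((2 * (i / 2) : ℕ) : ℝ) * (L / 2 ^ (m + 1)) := by
  push_cast
  rw [pow_succ]
  field_simp

/-- A component of the partial Fourier sum of `ψ₁ - ψ₂` at time `t` and position `x`. -/
noncomputable def fourierPartialSum (ψ₁ ψ₂ : ℝ → Ω → PeriodicL2 n) (c : Fin n) (I : Finset ℤ)
    (ω : Ω) (t x : ℝ) : ℝ :=
  ∑ k ∈ I, cas k x * coefDiff ψ₁ ψ₂ (k, c) t ω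

theorem lintegral_exp_dyadicIncrement_le {T p θ : ℝ} (hν : 0 < ν) (hT : 0 < T) (hε : 0 < ε)
    (hp0 : 0 < p) (hp1 : p ≤ 1) (hθ0 : 0 ≤ θ) (hθ1 : θ ≤ 1) (hq : 1 < (2 - 2 * p) * (1 - θ))
    (hW : IsCylindricalWiener P W) (hψε : IsStationarySolution P W ν ε ψε)
    (hψ0 : IsStationarySolution P W ν 0 ψ0) (c : Fin n) (I : Finset ℤ) (m i j : ℕ) {l : ℝ}
    (hl : l ^ 2 * (incrementScale ν T p θ * ε ^ (p * (1 - θ)) * ((1 / 2 : ℝ) ^ (θ / 2)) ^ m) ^ 2 ≤ 1) :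
    ∫⁻ ω, ENNReal.ofReal (Real.exp (l * dyadicIncrement (fun m i j ω =>
        fourierPartialSum ψε ψ0 c I ω (i * (T / 2 ^ m)) (j * (2 * Real.pi / 2 ^ m))) m i j ω)) ∂P
      ≤ ENNReal.ofReal (Real.exp 1) := by
  have key : ∀ (i' : ℕ) (α β : ℤ → ℝ), (∀ k, |α k| ≤ 1) → (∀ k, |β k| ≤ 1) →
      (∀ δ : ℝ, 0 < δ → ∀ J J' N : ℕ, ((J : ℝ) - J') * δ = ((i : ℝ) - i') * (T / 2 ^ m) →
        ∀ k ∈ I, (∑ j ∈ Finset.range N,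
          ouIncrementKernel (ν * k ^ 2 + 1) (ε ^ 2 * k ^ 4) δ (α k) (β k) J J' j ^ 2) * δ
            ≤ (4 + 16 * T + 8 * Real.pi ^ 2 / ν) * (1 / 2 : ℝ) ^ m) →
      ∫⁻ ω, ENNReal.ofReal (Real.exp (l * ∑ k ∈ I,
          (α k * coefDiff ψε ψ0 (k, c) (i * (T / 2 ^ m)) ω
            - β k * coefDiff ψε ψ0 (k, c) (i' * (T / 2 ^ m)) ω))) ∂P
        ≤ ENNReal.ofReal (Real.exp 1) := by
    intro i' α β hα hβ hρ
    refine (lintegral_exp_coefDiff_le hν hW hψε hψ0 hT c I m i i' α β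
      (fun k => modeConst ν T p θ * (ε ^ (p * (1 - θ))) ^ 2 * ((1 / 2 : ℝ) ^ m) ^ θ
        * |(k : ℝ)| ^ (-((2 - 2 * p) * (1 - θ)))) ?_ l).trans ?_
    · intro δ hδ J J' N hJ k hk
      refine le_modeConst_mul hν hT hp0 hθ0 hθ1 hε (by positivity) (by positivity) k ?_
        (hρ δ hδ J J' N hJ k hk)
      exact sum_ouIncrementKernel_sq_le_rpow (by positivity) (by positivity) hδ hp0.le hp1
        (hα k) (hβ k) J J' N
    · refine ENNReal.ofReal_le_ofReal (Real.exp_le_exp.2 (le_trans ?_ hl))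
      gcongr
      exact sum_mode_bound_le hν hT hε hq m I
  cases m with
  | zero =>
    have h := key i (fun k => cas k (j * (2 * Real.pi / 2 ^ 0))) (fun _ => 0)
      (fun k => abs_cas_le_one _ _) (fun k => by simp) (by
        intro δ hδ J J' N hJ k hk
        have h1 := sum_ouIncrementKernel_sq_le_rpow (a := ν * k ^ 2 + 1) (b := ε ^ 2 * k ^ 4)
          (p := 0) (d := 0) (by positivity) (by positivity) hδ le_rfl zero_le_one
          (abs_cas_le_one k (j * (2 * Real.pi / 2 ^ 0))) (by simp) J J' N
        refine h1.trans ?_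
        rw [Real.rpow_zero, pow_zero, mul_one]
        have h2 : 1 / (ν * (k : ℝ) ^ 2 + 1) ≤ 1 :=
          div_le_one_of_le₀ (by nlinarith [sq_nonneg (k : ℝ)]) (by positivity)
        have h3 : 0 ≤ 8 * Real.pi ^ 2 / ν := by positivity
        linarith)
    simpa [dyadicIncrement, fourierPartialSum] using h
  | succ m =>
    have h := key (2 * (i / 2)) (fun k => cas k (j * (2 * Real.pi / 2 ^ (m + 1))))
      (fun k => cas k ((2 * (j / 2) : ℕ) * (2 * Real.pi / 2 ^ (m + 1))))
      (fun k => abs_cas_le_one _ _) (fun k => abs_cas_le_one _ _) (by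
        intro δ hδ J J' N hJ k hk
        set x : ℝ := j * (2 * Real.pi / 2 ^ (m + 1)) with hx
        set y : ℝ := (2 * (j / 2) : ℕ) * (2 * Real.pi / 2 ^ (m + 1)) with hy
        refine (sum_ouIncrementKernel_sq_le_dist (d := cas k y) (by positivity) (by positivity) hδ
          (abs_cas_le_one k x) J J' N).trans ?_
        set ρ : ℝ := (1 / 2 : ℝ) ^ (m + 1) with hρ
        have hρ0 : 0 < ρ := by positivity
        have hρ1 : ρ ≤ 1 := pow_le_one₀ (by norm_num) (by norm_num)
        have hdiv : ∀ L : ℝ, L / 2 ^ (m + 1) = L * ρ := fun L => by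
          rw [hρ, one_div, inv_pow]; rfl
        have ht : |((J : ℝ) - J') * δ| ≤ T * ρ := by
          rw [hJ, hdiv, abs_mul, abs_of_pos (by positivity : 0 < T * ρ)]
          exact mul_le_of_le_one_left (by positivity) (natCast_sub_two_mul_half i)
        have hxy : |x - y| ≤ 2 * Real.pi * ρ := by
          rw [hx, hy, ← sub_mul, hdiv, abs_mul, abs_of_pos (by positivity : 0 < 2 * Real.pi * ρ)]
          exact mul_le_of_le_one_left (by positivity) (natCast_sub_two_mul_half j)
        have hc : (cas k x - cas k y) ^ 2 ≤ (k : ℝ) ^ 2 * (4 * Real.pi ^ 2 * ρ) := by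
          calc (cas k x - cas k y) ^ 2 = |cas k x - cas k y| ^ 2 := (sq_abs _).symm
            _ ≤ (|(k : ℝ)| * (2 * Real.pi * ρ)) ^ 2 := by
              refine pow_le_pow_left₀ (abs_nonneg _) ((abs_cas_sub_le k x y).trans ?_) 2
              gcongr
            _ = (k : ℝ) ^ 2 * (4 * Real.pi ^ 2 * (ρ * ρ)) := by
              rw [mul_pow, sq_abs]; ring
            _ ≤ _ := by
              gcongr
              exact mul_le_of_le_one_left hρ0.le hρ1
        have h3 : 2 * (cas k x - cas k y) ^ 2 / (ν * (k : ℝ) ^ 2 + 1) ≤ 8 * Real.pi ^ 2 / ν * ρ := by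
          rw [div_le_iff₀ (by positivity)]
          have e : 8 * Real.pi ^ 2 / ν * ρ * (ν * (k : ℝ) ^ 2 + 1)
              = 2 * ((k : ℝ) ^ 2 * (4 * Real.pi ^ 2 * ρ)) + 8 * Real.pi ^ 2 / ν * ρ := by
            field_simp
            ring
          rw [e]
          have : 0 ≤ 8 * Real.pi ^ 2 / ν * ρ := by positivity
          linarith
        nlinarith)
    refine le_trans (le_of_eq ?_) h
    refine lintegral_congr fun ω => ?_
    simp only [dyadicIncrement, fourierPartialSum, half_natCast_mul]
    rw [Finset.sum_sub_distrib]

/-- The constant in the bound for the expected supremum of a component. -/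
noncomputable def supConst (ν T p θ : ℝ) : ℝ :=
  ∑' m : ℕ, incrementScale ν T p θ * ((1 / 2 : ℝ) ^ (θ / 2)) ^ m * (2 * m + 8)

theorem incrementScale_pos {ν T : ℝ} (hν : 0 < ν) (hT : 0 < T) (p θ : ℝ) :
    0 < incrementScale ν T p θ := by
  have hZ : 0 ≤ ∑' k : ℤ, |(k : ℝ)| ^ (-((2 - 2 * p) * (1 - θ))) := tsum_nonneg fun k => by positivity
  have hK := modeConst_nonneg hν hT p θ
  unfold incrementScale
  positivity

theorem lintegral_iSup_fourierPartialSum_le {T p θ : ℝ} (hν : 0 < ν) (hT : 0 < T) (hε : 0 < ε)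
    (hp0 : 0 < p) (hp1 : p ≤ 1) (hθ0 : 0 < θ) (hθ1 : θ ≤ 1) (hq : 1 < (2 - 2 * p) * (1 - θ))
    (hW : IsCylindricalWiener P W) (hψε : IsStationarySolution P W ν ε ψε)
    (hψ0 : IsStationarySolution P W ν 0 ψ0) (c : Fin n) (I : Finset ℤ) :
    ∫⁻ ω, ⨆ (m : ℕ) (i : ℕ) (j : ℕ) (_ : i ≤ 2 ^ m) (_ : j ≤ 2 ^ m), ENNReal.ofReal
        |fourierPartialSum ψε ψ0 c I ω (i * (T / 2 ^ m)) (j * (2 * Real.pi / 2 ^ m))| ∂P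
      ≤ ENNReal.ofReal (supConst ν T p θ * ε ^ (p * (1 - θ))) := by
  have hPr : IsProbabilityMeasure P := hW.gaussian.isProbabilityMeasure
  have hsc := incrementScale_pos hν hT p θ
  set r : ℝ := (1 / 2 : ℝ) ^ (θ / 2) with hr
  have hr0 : 0 < r := by positivity
  have hr1 : r < 1 := Real.rpow_lt_one (by norm_num) (by norm_num) (by positivity)
  set σ : ℕ → ℝ := fun m => incrementScale ν T p θ * ε ^ (p * (1 - θ)) * r ^ m with hσ
  have hσ0 : ∀ m, 0 < σ m := fun m => by positivity
  have hsum : Summable fun m : ℕ => incrementScale ν T p θ * r ^ m * (2 * m + 8) := by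
    have h1 := summable_pow_mul_geometric_of_norm_lt_one 1
      (by rwa [Real.norm_of_nonneg hr0.le] : ‖r‖ < 1)
    have h2 := summable_geometric_of_lt_one hr0.le hr1
    refine ((h1.mul_left (2 * incrementScale ν T p θ)).add
      (h2.mul_left (8 * incrementScale ν T p θ))).congr fun m => ?_
    ring
  refine (lintegral_iSup_dyadic_le (σ := σ) (fun m i j => ?_) hσ0 (fun m i j _ _ => ?_)
    fun m i j _ _ => ?_).trans (le_of_eq ?_)
  · refine Finset.aemeasurable_fun_sum _ fun k _ => AEMeasurable.const_mul ?_ _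
    exact ((hψε.isOrnsteinUhlenbeck (k, c)).aemeasurable _).sub
      ((hψ0.isOrnsteinUhlenbeck (k, c)).aemeasurable _)
  · refine lintegral_exp_dyadicIncrement_le hν hT hε hp0 hp1 hθ0.le hθ1 hq hW hψε hψ0 c I m i j ?_
    rw [inv_pow]
    exact (inv_mul_cancel₀ (pow_pos (hσ0 m) 2).ne').le
  · refine lintegral_exp_dyadicIncrement_le hν hT hε hp0 hp1 hθ0.le hθ1 hq hW hψε hψ0 c I m i j ?_
    rw [neg_sq, inv_pow]
    exact (inv_mul_cancel₀ (pow_pos (hσ0 m) 2).ne').le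
  · rw [supConst, ← tsum_mul_right, ENNReal.ofReal_tsum_of_nonneg (fun m => by positivity)
      (hsum.mul_right _)]
    refine tsum_congr fun m => ?_
    simp only [hσ]
    congr 1
    ring

end Bounds

section Supremum

open Filter Topology

variable {n : ℕ} {Ω : Type*} {ν ε T : ℝ} {ψ₁ ψ₂ : ℝ → Ω → PeriodicL2 n}

theorem supLinftyDist_eq_iSup (T : ℝ) (ψ₁ ψ₂ : ℝ → Ω → PeriodicL2 n) (ω : Ω) :
    supLinftyDist T ψ₁ ψ₂ ω = ⨆ t : Set.Icc (0 : ℝ) T,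
      eLpNorm (ψ₁ t ω - ψ₂ t ω : PeriodicL2 n) ⊤ (volume.restrict (Set.Icc (0 : ℝ) (2 * Real.pi))) := by
  unfold supLinftyDist
  rw [iSup_subtype']
  exact iSup_congr fun t => eLpNorm_congr_ae (Lp.coeFn_sub _ _).symm

theorem iSup_eq_iSup_denseRange {X : Type*} [TopologicalSpace X] {u : ℕ → X} (hu : DenseRange u)
    {g : X → ℝ≥0∞} (hg : LowerSemicontinuous g) : ⨆ x, g x = ⨆ m, g (u m) := by
  refine le_antisymm (iSup_le fun x => le_of_forall_lt fun c hc => ?_)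
    (iSup_le fun m => le_iSup g (u m))
  obtain ⟨m, hm⟩ := hu.exists_mem_open (hg.isOpen_preimage c) ⟨x, hc⟩
  exact lt_of_lt_of_le hm (le_iSup (fun m => g (u m)) m)

theorem eLpNorm_top_sum_casTest_le (I : Finset ℤ) (a : ℤ × Fin n → ℝ) (M : Fin n → ℝ≥0∞)
    (hM : ∀ c, ∀ x ∈ Set.Icc (0 : ℝ) (2 * Real.pi),
      ENNReal.ofReal |∑ k ∈ I, cas k x * a (k, c)| ≤ M c) :
    eLpNorm (∑ c : Fin n, ∑ k ∈ I, a (k, c) • (casTest n (k, c)).toL2 : PeriodicL2 n) ⊤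
      (volume.restrict (Set.Icc (0 : ℝ) (2 * Real.pi))) ≤ ∑ c, M c := by
  have hcoe : (∑ c : Fin n, ∑ k ∈ I, a (k, c) • (casTest n (k, c)).toL2 : PeriodicL2 n)
      =ᵐ[volume.restrict (Set.Icc (0 : ℝ) (2 * Real.pi))]
        fun x => ∑ c : Fin n, (∑ k ∈ I, cas k x * a (k, c)) • EuclideanSpace.single c (1 : ℝ) := by
    have h1 : ∀ c, ((∑ k ∈ I, a (k, c) • (casTest n (k, c)).toL2 : PeriodicL2 n) : ℝ → _)
        =ᵐ[volume.restrict (Set.Icc (0 : ℝ) (2 * Real.pi))]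
          fun x => (∑ k ∈ I, cas k x * a (k, c)) • EuclideanSpace.single c (1 : ℝ) := by
      intro c
      have h2 : ∀ᵐ x ∂volume.restrict (Set.Icc (0 : ℝ) (2 * Real.pi)), ∀ k : ℤ,
          (a (k, c) • (casTest n (k, c)).toL2 : PeriodicL2 n) x
            = a (k, c) • cas k x • EuclideanSpace.single c (1 : ℝ) := by
        rw [ae_all_iff]
        intro k
        filter_upwards [Lp.coeFn_smul (a (k, c)) (casTest n (k, c)).toL2, casTest_coeFn (k, c)]
          with x hx hx'
        rw [hx, Pi.smul_apply, hx']
      filter_upwards [Lp.coeFn_fun_finsetSum I fun k => a (k, c) • (casTest n (k, c)).toL2, h2]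
        with x hx hx'
      rw [hx, Finset.sum_smul]
      refine Finset.sum_congr rfl fun k _ => ?_
      rw [hx', smul_smul, mul_comm]
    filter_upwards [Lp.coeFn_fun_finsetSum Finset.univ
      fun c => ∑ k ∈ I, a (k, c) • (casTest n (k, c)).toL2, ae_all_iff.2 h1] with x hx hx'
    rw [hx]
    exact Finset.sum_congr rfl fun c _ => hx' c
  rw [eLpNorm_congr_ae hcoe, eLpNorm_exponent_top]
  refine essSup_le_of_ae_le _ ?_
  filter_upwards [ae_restrict_mem measurableSet_Icc] with x hx
  refine (enorm_sum_le _ _).trans (Finset.sum_le_sum fun c _ => ?_)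
  rw [enorm_smul]
  refine le_trans (le_of_eq ?_) (hM c x hx)
  rw [Real.enorm_eq_ofReal_abs, ← ofReal_norm (EuclideanSpace.single c (1 : ℝ))]
  simp

/-- The supremum over all dyadic grid points of `[0, T] × [0, 2π]` of a component of the partial
Fourier sum with frequencies at most `N`. -/
noncomputable def dyadicSup (T : ℝ) (ψ₁ ψ₂ : ℝ → Ω → PeriodicL2 n) (c : Fin n) (N : ℕ) (ω : Ω) :
    ℝ≥0∞ :=
  ⨆ (m : ℕ) (i : ℕ) (j : ℕ) (_ : i ≤ 2 ^ m) (_ : j ≤ 2 ^ m), ENNReal.ofReal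
    |fourierPartialSum ψ₁ ψ₂ c (Finset.Icc (-(N : ℤ)) N) ω (i * (T / 2 ^ m))
      (j * (2 * Real.pi / 2 ^ m))|

theorem supLinftyDist_le_liminf (hT : 0 < T) {ω : Ω} (h₁ : Continuous fun t => ψ₁ t ω)
    (h₂ : Continuous fun t => ψ₂ t ω) :
    supLinftyDist T ψ₁ ψ₂ ω ≤ liminf (fun N : ℕ => ∑ c, dyadicSup T ψ₁ ψ₂ c N ω) atTop := by
  rw [supLinftyDist_eq_iSup]
  refine iSup_le fun t => ?_
  have hlsc := lowerSemicontinuous_eLpNorm_top (E := EuclideanSpace ℝ (Fin n))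
    (μ := volume.restrict (Set.Icc (0 : ℝ) (2 * Real.pi))) 2
  set v : PeriodicL2 n := ψ₁ t ω - ψ₂ t ω with hv
  have hlim := tendsto_sum_inner_casTest v
  refine (lowerSemicontinuousAt_iff_le_liminf.1 (hlsc v)).trans
    ((liminf_le_liminf_of_le hlim).trans ?_)
  change liminf (fun N : ℕ => eLpNorm (∑ c : Fin n, ∑ k ∈ Finset.Icc (-(N : ℤ)) N,
      inner ℝ v (casTest n (k, c)).toL2 • (casTest n (k, c)).toL2 : PeriodicL2 n) ⊤ _) atTop ≤ _
  refine liminf_le_liminf (Eventually.of_forall fun N => ?_)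
  refine eLpNorm_top_sum_casTest_le _ (fun i => inner ℝ v (casTest n i).toL2) _ fun c x hx => ?_
  have hG : Continuous (Function.uncurry
      (fourierPartialSum ψ₁ ψ₂ c (Finset.Icc (-(N : ℤ)) N) ω)) := by
    have hk : ∀ k : ℤ, Continuous fun q : ℝ × ℝ => cas k q.2 * coefDiff ψ₁ ψ₂ (k, c) q.1 ω :=
      fun k => ((continuous_cas k).comp continuous_snd).mul
        (((h₁.comp continuous_fst).inner continuous_const).sub
          ((h₂.comp continuous_fst).inner continuous_const))
    change Continuous fun q : ℝ × ℝ => ∑ k ∈ Finset.Icc (-(N : ℤ)) N,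
      cas k q.2 * coefDiff ψ₁ ψ₂ (k, c) q.1 ω
    exact continuous_finsetSum _ fun k _ => hk k
  refine le_trans (le_of_eq ?_) (ofReal_abs_le_iSup_dyadic hG hT (by positivity) t.2 hx)
  simp only [fourierPartialSum, coefDiff, hv, inner_sub_left]

variable [MeasurableSpace Ω] {P : Measure Ω} {W : ℝ → PeriodicL2 n → Ω → ℝ}

theorem aemeasurable_supLinftyDist (hT : 0 ≤ T) (h₁ : ∀ t, AEStronglyMeasurable (ψ₁ t) P)
    (h₂ : ∀ t, AEStronglyMeasurable (ψ₂ t) P) (hc₁ : ∀ᵐ ω ∂P, Continuous fun t => ψ₁ t ω)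
    (hc₂ : ∀ᵐ ω ∂P, Continuous fun t => ψ₂ t ω) : AEMeasurable (supLinftyDist T ψ₁ ψ₂) P := by
  have : Nonempty (Set.Icc (0 : ℝ) T) := ⟨⟨0, le_rfl, hT⟩⟩
  set u := TopologicalSpace.denseSeq (Set.Icc (0 : ℝ) T) with hu
  have hlsc := lowerSemicontinuous_eLpNorm_top (E := EuclideanSpace ℝ (Fin n))
    (μ := volume.restrict (Set.Icc (0 : ℝ) (2 * Real.pi))) 2
  have hmeas : AEMeasurable (fun ω => ⨆ m, eLpNorm (ψ₁ (u m) ω - ψ₂ (u m) ω : PeriodicL2 n) ⊤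
      (volume.restrict (Set.Icc (0 : ℝ) (2 * Real.pi)))) P := by
    borelize (PeriodicL2 n)
    exact AEMeasurable.iSup fun m => hlsc.measurable.comp_aemeasurable
      ((h₁ (u m)).sub (h₂ (u m))).aemeasurable
  refine hmeas.congr ?_
  filter_upwards [hc₁, hc₂] with ω hω₁ hω₂
  rw [supLinftyDist_eq_iSup]
  refine (iSup_eq_iSup_denseRange (TopologicalSpace.denseRange_denseSeq (Set.Icc (0 : ℝ) T))
    (g := fun t => eLpNorm (ψ₁ t ω - ψ₂ t ω : PeriodicL2 n) ⊤ _) ?_).symm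
  exact hlsc.comp ((hω₁.comp continuous_subtype_val).sub (hω₂.comp continuous_subtype_val))

theorem aemeasurable_dyadicSup (h₁ : ∀ t, AEStronglyMeasurable (ψ₁ t) P)
    (h₂ : ∀ t, AEStronglyMeasurable (ψ₂ t) P) (c : Fin n) (N : ℕ) :
    AEMeasurable (dyadicSup T ψ₁ ψ₂ c N) P := by
  refine AEMeasurable.iSup fun m => AEMeasurable.iSup fun i => AEMeasurable.iSup fun j =>
    AEMeasurable.iSup fun _ => AEMeasurable.iSup fun _ => ?_
  refine AEMeasurable.ennreal_ofReal (AEMeasurable.abs ?_)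
  refine Finset.aemeasurable_fun_sum _ fun k _ => AEMeasurable.const_mul ?_ _
  exact ((h₁ _).inner aestronglyMeasurable_const).aemeasurable.sub
    ((h₂ _).inner aestronglyMeasurable_const).aemeasurable

theorem lintegral_supLinftyDist_le {p θ : ℝ} (hν : 0 < ν) (hT : 0 < T) (hε : 0 < ε)
    (hp0 : 0 < p) (hp1 : p ≤ 1) (hθ0 : 0 < θ) (hθ1 : θ ≤ 1) (hq : 1 < (2 - 2 * p) * (1 - θ))
    (hW : IsCylindricalWiener P W) (hψε : IsStationarySolution P W ν ε ψ₁)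
    (hψ0 : IsStationarySolution P W ν 0 ψ₂) :
    ∫⁻ ω, supLinftyDist T ψ₁ ψ₂ ω ∂P
      ≤ ENNReal.ofReal (n * supConst ν T p θ * ε ^ (p * (1 - θ))) := by
  have hm := fun c N => aemeasurable_dyadicSup (T := T) hψε.measurable hψ0.measurable c N
  calc ∫⁻ ω, supLinftyDist T ψ₁ ψ₂ ω ∂P
      ≤ ∫⁻ ω, liminf (fun N : ℕ => ∑ c, dyadicSup T ψ₁ ψ₂ c N ω) atTop ∂P := by
        refine lintegral_mono_ae ?_
        filter_upwards [hψε.continuous_paths, hψ0.continuous_paths] with ω h₁ h₂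
        exact supLinftyDist_le_liminf hT h₁ h₂
    _ ≤ liminf (fun N : ℕ => ∫⁻ ω, ∑ c, dyadicSup T ψ₁ ψ₂ c N ω ∂P) atTop :=
        lintegral_liminf_le' fun N => Finset.aemeasurable_fun_sum _ fun c _ => hm c N
    _ ≤ liminf (fun _ : ℕ => ENNReal.ofReal (n * supConst ν T p θ * ε ^ (p * (1 - θ)))) atTop := by
        refine liminf_le_liminf (Eventually.of_forall fun N => ?_)
        rw [lintegral_finsetSum' _ fun c _ => hm c N]
        refine (Finset.sum_le_sum fun c _ => lintegral_iSup_fourierPartialSum_le hν hT hε hp0 hp1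
          hθ0 hθ1 hq hW hψε hψ0 c _).trans (le_of_eq ?_)
        rw [Finset.sum_const, Finset.card_univ, Fintype.card_fin, nsmul_eq_mul, mul_assoc,
          ENNReal.ofReal_mul (Nat.cast_nonneg n), ENNReal.ofReal_natCast]
    _ = _ := by simp

theorem supConst_nonneg (hν : 0 < ν) (hT : 0 < T) (p θ : ℝ) : 0 ≤ supConst ν T p θ :=
  tsum_nonneg fun m => by
    have := incrementScale_pos hν hT p θ
    positivity

end Supremum

theorem mainTheorem5 (n : ℕ) (ν : ℝ) (hν : 0 < ν) (κ : ℝ) (hκ : 0 < κ) (T : ℝ) (hT : 0 < T) :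
    ∃ C : ℝ, 0 < C ∧ ∀ ε : ℝ, 0 < ε → ε < 1 →
      ∀ (Ω : Type*) [MeasurableSpace Ω] (P : Measure Ω) [IsProbabilityMeasure P]
        (W : ℝ → PeriodicL2 n → Ω → ℝ) (ψε ψ0 : ℝ → Ω → PeriodicL2 n),
        IsCylindricalWiener P W →
        IsStationarySolution P W ν ε ψε →
        IsStationarySolution P W ν 0 ψ0 →
        AEMeasurable (supLinftyDist T ψε ψ0) P ∧
          ∫⁻ ω, supLinftyDist T ψε ψ0 ω ∂P ≤ ENNReal.ofReal (C * ε ^ ((1 : ℝ) / 2 - κ)) := by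
  obtain ⟨a, ha0, ha1, haκ⟩ : ∃ a : ℝ, 0 < a ∧ a ≤ 1 / 4 ∧ a ≤ κ :=
    ⟨min κ (1 / 4), lt_min hκ (by norm_num), min_le_right _ _, min_le_left _ _⟩
  set p : ℝ := 1 / 2 - a / 2 with hp
  set θ : ℝ := a / 2 with hθ
  have hS := supConst_nonneg hν hT p θ
  refine ⟨n * supConst ν T p θ + 1, by positivity, ?_⟩
  intro ε hε hε1 Ω _ P _ W ψε ψ0 hW hψε hψ0
  refine ⟨aemeasurable_supLinftyDist hT.le hψε.measurable hψ0.measurable hψε.continuous_paths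
    hψ0.continuous_paths, ?_⟩
  refine (lintegral_supLinftyDist_le (p := p) (θ := θ) hν hT hε (by linarith) (by linarith)
    (by positivity) (by linarith) (by rw [hp, hθ]; nlinarith) hW hψε hψ0).trans ?_
  refine ENNReal.ofReal_le_ofReal ?_
  have hexp : ε ^ (p * (1 - θ)) ≤ ε ^ ((1 : ℝ) / 2 - κ) :=
    Real.rpow_le_rpow_of_exponent_ge hε hε1.le (by rw [hp, hθ]; nlinarith)
  gcongr
  linarith
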